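/- **Setting.** Let $G$ be a connected undirected multigraph with $m$ edges and at least two and at most $n$ vertices, let $\lambda$ be its minimum cut value, and assume that all $3\lambda$-strong components of $G$ are contracted, i.e. no induced subgraph on at least two vertices is $3\lambda$-edge-connected. Let $p\in(0,1)$. All logarithms are natural. A cut $C$ is the set of edges crossing a bipartition of the vertices into two non-empty sides. The load of an edge $e$ induced by a multiset $\mathcal S$ of trees is $\ell^{\mathcal S}(e)=|\{T\in\mathcal S: e\in T\}|/|\mathcal S|$ (and $0$ if $\mathcal S=\emptyset$), and $\ell^{\mathcal S}(C)=\sum_{e\in C}\ell^{\mathcal S}(e)$. In a greedy tree packing $T_1,T_2,\dots$, each $T_i$ is a minimum spanning tree with respect to the loads induced by $T_1,\dots,T_{i-1}$. *Tree packing and levels.* Let $\delta=\Theta(1/\log\log n)$ and $0<\varepsilon\le\kappa\delta$, where $\kappa>0$ is a sufficiently small absolute constant. Let $R\ge 1$ be an integer with $R\ge 6\lambda\ln m/\varepsilon^2$, and let $\mathcal T$ be the multiset of the last $R$ trees of a greedy tree packing with $2R$ trees. For $i\in\mathbb Z$ put $\pi_i=(1+\delta)^i\lambda/2$ and $\widetilde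 E_i=\{e: \ell^{\mathcal T}(e)\in[1/\pi_i,1/\pi_{i-1})\}$, and let $\tilde k_{\pi_i}$ be the number of nodes left after contracting all edges with $\ell^{\mathcal T}(e)<1/\pi_i$. Let $L$ be the least integer with $\pi_L\ge 3\lambda$. *Cut sampler.* Let $\widetilde{\mathcal T}$ consist of $N$ trees sampled from $\mathcal T$ uniformly, independently and with replacement, where $N$ is polylogarithmic in $n$, i.e. $(\log n)^{a_0}\le N\le(\log n)^{a}$ with $a_0$ a sufficiently large absolute constant and $a$ any constant. Given $\widetilde{\mathcal T}$, let $q$ be the distribution of the following random cut: choose $T\in\widetilde{\mathcal T}$ uniformly; choose integers $(j_i)_{0\le i\le L+1}$ uniformly among the non-negative vectors with $\sum_i j_i\le 8\log n$ and $j_i\le|E(T)\cap\widetilde E_i|$ for all $i$; independently for each $i$ choose $j_i$ edges of $E(T)\cap\widetilde E_i$ uniformly without replacement; output the set of edges of $G$ crossing the unique vertex bipartition that is crossed by exactly the chosen edges of $T$. Let $z'=\sum_{C:\ \ell^{\mathcal T}(C)\le 2\log n}p^{|C|}$, and let $\rho(C)=\frac{p^{|C|}}{q(C)\,z'}$ be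 the likelihood ratio of a cut $C$. **Lemma.** Assume that $n^{1+30\delta}\,\tilde k_{\pi_i}\,p^{2\pi_i}\le 1$ for all $i\ge 0$ and that $p^{\lambda}\ge n^{-1000}$. Then, with high probability over the choice of $\widetilde{\mathcal T}$, every cut $C$ with $\ell^{\mathcal T}(C)\le 2\log n$ satisfies $q(C)>0$ and $$\rho(C)\le(\log n)^{O(1/\delta)}\,n^{1+O(\delta)} .$$ Precisely: there are $\kappa>0$ and $a_0>0$ such that for every $a$ there is $K>0$ such that for all $c_1,c_2,c>0$ there is $n_0$ such that, for all $n\ge n_0$, all $\delta$ with $\frac{c_1}{\log\log n}\le\delta\le\frac{c_2}{\log\log n}$ and all $\varepsilon, G, p, R, \mathcal T, N$ as above that satisfy the two assumptions, the probability that every cut $C$ with $\ell^{\mathcal T}(C)\le 2\log n$ has $q(C)>0$ and $\rho(C)\le(\log n)^{K/\delta}n^{1+K\delta}$ is at least $1-n^{-c}$. -/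

import Mathlib

open Graph

noncomputable section

open Classical in
/-- The cut `∂A`: the set of edges of the multigraph `G` with exactly one endpoint in `A`. -/
def cutEdges {α β : Type*} [Fintype β] (G : Graph α β) (A : Set α) : Finset β :=
  Finset.univ.filter fun e => ∃ x ∈ A, ∃ y ∉ A, G.IsLink e x y

open Classical in
/-- All cuts of `G`, as edge sets `∂A` with `∅ ≠ A ⊊ V(G)`. In a connected graph the edge set
`∂A` determines the bipartition `{A, V(G) \ A}`, so every bipartition is counted once. -/
def cuts {α β : Type*} [Fintype β] (G : Graph α β) : Finset (Finset β) :=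
  Finset.univ.filter fun C => ∃ A : Set α, A ⊆ V(G) ∧ A.Nonempty ∧ A ≠ V(G) ∧ C = cutEdges G A

/-- The value `λ` of a minimum cut. -/
def minCut {α β : Type*} [Fintype β] (G : Graph α β) : ℕ :=
  sInf {k | ∃ C ∈ cuts G, C.card = k}

/-- Every cut has at least `k` edges. -/
def IsEdgeConnected {α β : Type*} [Fintype β] (G : Graph α β) (k : ℕ) : Prop :=
  ∀ C ∈ cuts G, k ≤ C.card

/-- All `k`-strong components (maximal `k`-edge-connected induced subgraphs) of `G` are single
vertices, which is the situation after all `k`-strong components have been contracted. -/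
def StrongComponentsTrivial {α β : Type*} [Fintype β] (G : Graph α β) (k : ℕ) : Prop :=
  ∀ S : Set α, S ⊆ V(G) → IsEdgeConnected (G.induce S) k → S.Subsingleton

/-- Two vertices are equivalent if they are joined by a path with edges in `F`. -/
def joinedBy {α β : Type*} (G : Graph α β) (F : Set β) : Setoid V(G) :=
  Relation.EqvGen.setoid fun x y => ∃ e ∈ F, G.IsLink e x y

/-- The number of vertices that are left after contracting all edges in `F`. -/
def numNodesAfterContracting {α β : Type*} (G : Graph α β) (F : Set β) : ℕ :=
  Nat.card (Quotient (joinedBy G F))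

/-- The edges in `F` connect all vertices of `G`. -/
def Connects {α β : Type*} (G : Graph α β) (F : Set β) : Prop :=
  ∀ x y : V(G), joinedBy G F x y

/-- `T` is (the edge set of) a spanning tree: it connects `V(G)` and has `|V(G)| - 1` edges. -/
def IsSpanningTree {α β : Type*} (G : Graph α β) (T : Finset β) : Prop :=
  (∀ e ∈ T, e ∈ E(G)) ∧ Connects G (T : Set β) ∧ T.card + 1 = V(G).ncard

/-- `T` is a minimum spanning tree with respect to the edge weights `w`. -/
def IsMinSpanningTree {α β : Type*} (G : Graph α β) (w : β → ℝ) (T : Finset β) : Prop :=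
  IsSpanningTree G T ∧ ∀ T', IsSpanningTree G T' → ∑ e ∈ T, w e ≤ ∑ e ∈ T', w e

open Classical in
/-- The load `ℓ^𝒯(e)` induced by a (multi-)set `𝒯` of `N` trees: the fraction of the trees
that contain `e` (and `0` if `N = 0`). -/
def load {β : Type*} {N : ℕ} (𝒯 : Fin N → Finset β) (e : β) : ℝ :=
  ((Finset.univ.filter fun j => e ∈ 𝒯 j).card : ℝ) / N

/-- `T 0, …, T (k - 1)` is a possible run of `k` rounds of greedy tree packing: each tree is a
minimum spanning tree for the loads induced by the previous trees. -/
def IsGreedyTreePacking {α β : Type*} (G : Graph α β) (k : ℕ) (T : ℕ → Finset β) : Prop :=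
  ∀ i < k, IsMinSpanningTree G (load fun j : Fin i => T j) (T i)

/-- The latter half of `2 * R` rounds of greedy tree packing. -/
def latterHalf {β : Type*} (T : ℕ → Finset β) (R : ℕ) : Fin R → Finset β :=
  fun j => T (R + j)

/-- `π_i = (1 + δ)^i λ / 2`. -/
def levelPi (lam : ℕ) (δ : ℝ) (i : ℕ) : ℝ := (1 + δ) ^ i * lam / 2

/-- The surrogate parameter `k̃_{π_i}`: the number of nodes after contracting all edges `e` with
`ℓ e < 1 / π_i`. -/
def kTilde {α β : Type*} [Fintype β] (G : Graph α β) (δ : ℝ) (ℓ : β → ℝ) (i : ℕ) : ℕ :=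
  numNodesAfterContracting G {e | ℓ e < 1 / levelPi (minCut G) δ i}

open Classical in
/-- The level `Ẽ_i`: the edges `e` with `ℓ e ∈ [1 / π_i, 1 / π_{i-1})`, where
`1 / π_{i-1} = (1 + δ) / π_i`. -/
def level {α β : Type*} [Fintype β] (G : Graph α β) (δ : ℝ) (ℓ : β → ℝ) (i : ℕ) : Finset β :=
  Finset.univ.filter fun e =>
    e ∈ E(G) ∧ 1 / levelPi (minCut G) δ i ≤ ℓ e ∧ ℓ e < (1 + δ) / levelPi (minCut G) δ i

/-- The number of levels. With `L` the least integer such that `π_L ≥ 3λ`, the half-open load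
intervals of levels `1, …, L` cover `[1 / (3λ), 2 / λ)`. Loads of the approximate packing may
leave this range by a factor `1 + δ`, so the levels `0` and `L + 1` are used as well. -/
def numLevels (δ : ℝ) : ℕ := ⌈Real.log 6 / Real.log (1 + δ)⌉₊ + 2

/-- The extension of a function on edges to edge sets, `ℓ(C) = ∑_{e ∈ C} ℓ(e)`. -/
def cutLoad {β : Type*} (ℓ : β → ℝ) (C : Finset β) : ℝ := ∑ e ∈ C, ℓ e

open Classical in
/-- The collection `𝒞` of cuts `C` with `ℓ(C) ≤ 2 log n`. -/
def relevantCuts {α β : Type*} [Fintype β] (G : Graph α β) (n : ℕ) (ℓ : β → ℝ) :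
    Finset (Finset β) :=
  (cuts G).filter fun C => cutLoad ℓ C ≤ 2 * Real.log n

/-- `z' = ∑_{C ∈ 𝒞} p^{|C|}`. -/
def zPrime {α β : Type*} [Fintype β] (G : Graph α β) (n : ℕ) (ℓ : β → ℝ) (p : ℝ) : ℝ :=
  ∑ C ∈ relevantCuts G n ℓ, p ^ C.card

open Classical in
/-- The admissible vectors `(j_i)`: `∑_i j_i ≤ 8 log n` and `j_i ≤ |E(T) ∩ Ẽ_i|` for all `i`. -/
def admissible {α β : Type*} [Fintype β] (G : Graph α β) (n : ℕ) (δ : ℝ) (ℓ : β → ℝ)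
    (T : Finset β) : Finset (Fin (numLevels δ) → ℕ) :=
  (Fintype.piFinset fun i : Fin (numLevels δ) =>
      Finset.range ((T ∩ level G δ ℓ i).card + 1)).filter
    fun j => ((∑ i, j i : ℕ) : ℝ) ≤ 8 * Real.log n

theorem admissible_nonempty {α β : Type*} [Fintype β] (G : Graph α β) (n : ℕ) (δ : ℝ)
    (ℓ : β → ℝ) (T : Finset β) : (admissible G n δ ℓ T).Nonempty := by
  refine ⟨fun _ => 0, ?_⟩
  have h : 0 ≤ Real.log n := Real.log_natCast_nonneg n
  simp only [admissible, Finset.mem_filter, Fintype.mem_piFinset, Finset.mem_range]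
  refine ⟨fun i => Nat.succ_pos _, ?_⟩
  simpa using h

open Classical in
/-- All ways to choose `j_i` edges (without repetition) from `E(T) ∩ Ẽ_i`, for every `i`. -/
def edgeChoices {α β : Type*} [Fintype β] (G : Graph α β) (δ : ℝ) (ℓ : β → ℝ)
    (T : Finset β) (j : Fin (numLevels δ) → ℕ) : Finset (Fin (numLevels δ) → Finset β) :=
  Fintype.piFinset fun i => (T ∩ level G δ ℓ i).powersetCard (j i)

theorem edgeChoices_nonempty {α β : Type*} [Fintype β] (G : Graph α β) (n : ℕ) (δ : ℝ)
    (ℓ : β → ℝ) (T : Finset β) (j : Fin (numLevels δ) → ℕ) (hj : j ∈ admissible G n δ ℓ T) :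
    (edgeChoices G δ ℓ T j).Nonempty := by
  classical
  simp only [admissible, Finset.mem_filter, Fintype.mem_piFinset, Finset.mem_range] at hj
  refine Fintype.piFinset_nonempty.2 fun i => Finset.powersetCard_nonempty.2 ?_
  convert Nat.lt_succ_iff.1 (hj.1 i)

open Classical in
/-- The cut defined by a set `F` of edges of a spanning tree `T`: the set of all edges crossing
the (unique) vertex bipartition that is crossed by exactly the edges `F` of `T`. -/
def cutOfTreeEdges {α β : Type*} [Fintype β] (G : Graph α β) (T F : Finset β) : Finset β :=
  if h : ∃ A : Set α, A ⊆ V(G) ∧ cutEdges G A ∩ T = F then cutEdges G h.choose else ∅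

open Classical in
/-- The cut sampling algorithm on one tree `T`: sample `(j_i)` uniformly among the admissible
vectors, then `j_i` edges of `E(T) ∩ Ẽ_i` uniformly without replacement, independently for all
`i`, and output the cut defined by the sampled tree edges. -/
def treeCutSampler {α β : Type*} [Fintype β] (G : Graph α β) (n : ℕ) (δ : ℝ) (ℓ : β → ℝ)
    (T : Finset β) : PMF (Finset β) :=
  haveI : Nonempty {j // j ∈ admissible G n δ ℓ T} := (admissible_nonempty G n δ ℓ T).to_subtype
  (PMF.uniformOfFintype {j // j ∈ admissible G n δ ℓ T}).bind fun j =>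
    (PMF.uniformOfFinset (edgeChoices G δ ℓ T j.1)
      (edgeChoices_nonempty G n δ ℓ T j.1 j.2)).map fun F =>
        cutOfTreeEdges G T (Finset.univ.biUnion F)

/-- The distribution `q` on cuts: sample a uniformly random tree of the sparsified packing
`𝒯'`, then sample a cut on this tree. -/
def cutSampler {α β : Type*} [Fintype β] (G : Graph α β) (n : ℕ) (δ : ℝ) (ℓ : β → ℝ)
    {N : ℕ} [NeZero N] (𝒯' : Fin N → Finset β) : PMF (Finset β) :=
  (PMF.uniformOfFintype (Fin N)).bind fun k => treeCutSampler G n δ ℓ (𝒯' k)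

/-- The likelihood ratio `ρ(C) = p^{|C|} / (q(C) z')`. -/
def likelihoodRatio {α β : Type*} [Fintype β] (G : Graph α β) (n : ℕ) (ℓ : β → ℝ) (p : ℝ)
    (q : PMF (Finset β)) (C : Finset β) : ℝ :=
  p ^ C.card / ((q C).toReal * zPrime G n ℓ p)

end

/-!
The load of an edge under greedy tree packing is governed by the principal partition of the
graphic matroid. For a parameter `π`, let `F` be an edge set that maximizes
`|F| + π · k(F)`, where `k(F)` is the number of nodes after contracting `F` (`IsPrincipal`).
By Kruskal's property, a minimum spanning tree uses at most a `1 / π` fraction of the edges of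
`F` above any weight threshold, and at least a `1 / π` fraction of the other edges below any
threshold. Since greedy packing takes minimum spanning trees for the current loads, the potentials
`∑ (1 + η) ^ (uses of e)` over `F` and `∑ (1 - η) ^ (uses of e)` over the complement of `F` change
by factors of about `1 ± η / π` per round. Hence after enough rounds the edges in `F` have load at
most about `1 / π`, and the other edges at least about `1 / π`
(`IsGreedyTreePacking.useCount_le`, `IsGreedyTreePacking.le_useCount`). For `π ≤ λ / 2` the set `F`
is everything, and for `π ≥ 3 λ` it consists of loops because the strong components are
contracted. So the loads of the latter half lie in the range of the levels, and are accurate up to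
a factor `1 + O(δ)` (`IsAccuratePacking.load_bounds`).

For each level `i` this gives a contraction with `k_i ≤ k̃_{π_{i+1}}` nodes such that every tree of
the latter half has fewer than `k_i` edges in the level, while at most `π_{i+1} (k_i - 1)` edges of
the graph remain (`IsAccuratePacking.exists_contraction`). By Markov's inequality the degree cuts
of the contracted graph yield `z' ≥ (δ / 4) k_i p ^ (2 π_{i+1} (1 + δ))` (`mul_rpow_le_zPrime`);
also `z' ≥ p ^ λ`.

On a tree `T` the sampler finds a cut `C` with probability at least
`1 / (polylog · ∏ k(e))`, the product over the edges `e ∈ T ∩ C`, where `k(e)` belongs to the level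
of `e`. If the load of `C` is less than `2 - δ`, a `δ` fraction of the trees crosses `C` in one
edge only, the product is at most `n`, and `z' ≥ p ^ λ ≥ p ^ |C|` suffices. Otherwise give `e` the
cost `v(e) = (log n + log k(e)) / 2`. Its mean total over `T ∩ C` is `∑_{e ∈ C} ℓ(e) v(e)`, and by
Markov's inequality for a `δ / 2` fraction of the trees the total stays below `1 + δ`
times the mean. As `v(e) ≥ log n / 2`, such trees cross `C` in at most `8 log n` edges. The assumption
`n ^ (1 + 30 δ) k̃_π p ^ (2 π) ≤ 1` says that `v(e)` is less than `π log (1 / p)`, which sums to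
about `|C| log (1 / p)`. As the load of `C` is at least `2 - δ`, nearly twice the smallest slack in these
inequalities is gained, and this is what the bound for `z'` at the level with the smallest
slack loses (`exponent_estimate`, `exists_good_trees`).

Finally, a cut is determined by the edges in which it crosses a tree, so there are only
`n ^ O(log n)` relevant cuts, and the union bound over them shows that a polylogarithmic sample
contains a good tree for each of them with high probability.
-/

noncomputable section

section

open Classical

variable {α β : Type*}

/-! ### Components and their number -/

theorem joinedBy_of_isLink {G : Graph α β} {F : Set β} {e : β} {x y : V(G)} (he : e ∈ F)
    (h : G.IsLink e x y) : joinedBy G F x y :=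
  Relation.EqvGen.rel _ _ ⟨e, he, h⟩

theorem joinedBy_le {G : Graph α β} {F : Set β} {r : Setoid V(G)}
    (h : ∀ e ∈ F, ∀ x y : V(G), G.IsLink e x y → r x y) : joinedBy G F ≤ r := by
  apply Setoid.eqvGen_le
  rintro x y ⟨e, he, hl⟩
  exact h e he x y hl

theorem joinedBy_mono {G : Graph α β} {F F' : Set β} (h : F ⊆ F') :
    joinedBy G F ≤ joinedBy G F' :=
  joinedBy_le fun _ he _ _ hl => joinedBy_of_isLink (h he) hl

/-- A vertex predicate that no edge of `F` crosses is constant on the components of `F`. -/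
theorem iff_of_joinedBy {G : Graph α β} {F : Set β} {P : α → Prop}
    (h : ∀ e ∈ F, ∀ x y, G.IsLink e x y → (P x ↔ P y)) {x y : V(G)} (hxy : joinedBy G F x y) :
    P x ↔ P y := by
  let r : Setoid V(G) := ⟨fun x y => P x ↔ P y, fun _ => Iff.rfl, Iff.symm, Iff.trans⟩
  exact joinedBy_le (r := r) (fun e he x y hl => h e he x y hl) hxy

theorem numNodes_eq_one_iff {G : Graph α β} (hV : V(G).Nonempty) {F : Set β} :
    numNodesAfterContracting G F = 1 ↔ Connects G F := by
  rw [numNodesAfterContracting, Nat.card_eq_one_iff_unique]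
  constructor
  · rintro ⟨h, -⟩ x y
    exact Quotient.exact' (Subsingleton.elim (Quotient.mk'' x : Quotient (joinedBy G F)) _)
  · intro h
    obtain ⟨x, hx⟩ := hV
    refine ⟨⟨fun a b => ?_⟩, ⟨Quotient.mk'' ⟨x, hx⟩⟩⟩
    induction a, b using Quotient.inductionOn₂' with
    | h a b => exact Quotient.sound' (h a b)

variable [Finite α]

theorem card_quotient_le_of_le {V : Type*} [Finite V] {r s : Setoid V} (h : r ≤ s) :
    Nat.card (Quotient s) ≤ Nat.card (Quotient r) := by
  refine Nat.card_le_card_of_surjective (Quotient.map' id fun _ _ hab => h hab) ?_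
  intro q
  induction q using Quotient.inductionOn' with
  | h a => exact ⟨Quotient.mk'' a, rfl⟩

theorem card_quotient_lt_of_le {V : Type*} [Finite V] {r s : Setoid V} (h : r ≤ s) {x y : V}
    (hs : s x y) (hr : ¬ r x y) : Nat.card (Quotient s) < Nat.card (Quotient r) := by
  refine lt_of_le_of_ne (card_quotient_le_of_le h) fun hcard => hr ?_
  let f : Quotient r → Quotient s := Quotient.map' id fun _ _ hab => h hab
  have hsurj : Function.Surjective f := by
    intro q
    induction q using Quotient.inductionOn' with
    | h a => exact ⟨Quotient.mk'' a, rfl⟩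
  have hbij := (Nat.bijective_iff_surjective_and_card f).2 ⟨hsurj, hcard.symm⟩
  have : (Quotient.mk'' x : Quotient r) = Quotient.mk'' y := hbij.1 (Quotient.sound' hs)
  exact Quotient.exact' this

theorem numNodes_le_of_le {G : Graph α β} {F F' : Set β} (h : joinedBy G F ≤ joinedBy G F') :
    numNodesAfterContracting G F' ≤ numNodesAfterContracting G F :=
  card_quotient_le_of_le h

theorem numNodes_anti {G : Graph α β} {F F' : Set β} (h : F ⊆ F') :
    numNodesAfterContracting G F' ≤ numNodesAfterContracting G F :=
  numNodes_le_of_le (joinedBy_mono h)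

omit [Finite α] in
theorem numNodes_empty (G : Graph α β) : numNodesAfterContracting G ∅ = V(G).ncard := by
  have h : joinedBy G ∅ = ⊥ := by
    refine le_antisymm (joinedBy_le fun e he => absurd he (Set.notMem_empty e)) bot_le
  rw [numNodesAfterContracting, h, ← Nat.card_coe_set_eq]
  exact (Nat.card_congr (Equiv.ofBijective (fun x : V(G) => (Quotient.mk'' x : Quotient ⊥))
    ⟨fun x y hxy => Quotient.exact' hxy, Quotient.mk''_surjective⟩)).symm

theorem numNodes_pos {G : Graph α β} (hV : V(G).Nonempty) (F : Set β) :
    0 < numNodesAfterContracting G F := by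
  obtain ⟨x, hx⟩ := hV
  have : Nonempty (Quotient (joinedBy G F)) := ⟨Quotient.mk'' ⟨x, hx⟩⟩
  exact Nat.card_pos

theorem numNodes_le_ncard (G : Graph α β) (F : Set β) :
    numNodesAfterContracting G F ≤ V(G).ncard :=
  (numNodes_anti (Set.empty_subset F)).trans (numNodes_empty G).le

/-- An edge whose ends are already joined does not change the components. -/
theorem numNodes_insert_of_joinedBy {G : Graph α β} {F : Set β} {e : β} {x y : V(G)}
    (hl : G.IsLink e x y) (h : joinedBy G F x y) :
    numNodesAfterContracting G (insert e F) = numNodesAfterContracting G F := by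
  refine le_antisymm (numNodes_anti (Set.subset_insert _ _)) (numNodes_le_of_le ?_)
  refine joinedBy_le fun e' he' u v hl' => ?_
  rcases he' with rfl | he'
  · rcases hl.eq_and_eq_or_eq_and_eq hl' with ⟨h1, h2⟩ | ⟨h1, h2⟩
    · rwa [← Subtype.ext h1, ← Subtype.ext h2]
    · rw [← Subtype.ext h1, ← Subtype.ext h2]; exact (joinedBy G F).symm h
  · exact joinedBy_of_isLink he' hl'

theorem numNodes_insert_of_notMem {G : Graph α β} {F : Set β} {e : β} (he : e ∉ E(G)) :
    numNodesAfterContracting G (insert e F) = numNodesAfterContracting G F := by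
  refine le_antisymm (numNodes_anti (Set.subset_insert _ _)) (numNodes_le_of_le ?_)
  refine joinedBy_le fun e' he' u v hl' => ?_
  rcases he' with rfl | he'
  · exact absurd hl'.edge_mem he
  · exact joinedBy_of_isLink he' hl'

theorem numNodes_le_insert_add_one (G : Graph α β) (F : Set β) (e : β) :
    numNodesAfterContracting G F ≤ numNodesAfterContracting G (insert e F) + 1 := by
  by_cases he : e ∈ E(G)
  swap
  · rw [numNodes_insert_of_notMem he]; exact Nat.le_succ _
  obtain ⟨x, y, hl⟩ := exists_isLink_of_mem_edgeSet he
  let x' : V(G) := ⟨x, hl.left_mem⟩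
  let y' : V(G) := ⟨y, hl.right_mem⟩
  have hl' : G.IsLink e x' y' := hl
  by_cases hj : joinedBy G F x' y'
  · rw [numNodes_insert_of_joinedBy hl' hj]; exact Nat.le_succ _
  -- Redirecting the class of `x'` to that of `y'` identifies the ends of `e`.
  let f : V(G) → Quotient (joinedBy G F) := fun v =>
    if joinedBy G F v x' then Quotient.mk'' y' else Quotient.mk'' v
  have hfx : f x' = Quotient.mk'' y' := if_pos ((joinedBy G F).refl x')
  have hfy : f y' = Quotient.mk'' y' := if_neg fun h => hj ((joinedBy G F).symm h)
  have hf : ∀ u v, joinedBy G (insert e F) u v → f u = f v := by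
    intro u v huv
    refine joinedBy_le (r := Setoid.ker f) ?_ huv
    rintro e' (rfl | he') a b hab
    · rcases hl'.eq_and_eq_or_eq_and_eq hab with ⟨h1, h2⟩ | ⟨h1, h2⟩
      · rw [← Subtype.ext h1, ← Subtype.ext h2]; exact hfx.trans hfy.symm
      · rw [← Subtype.ext h1, ← Subtype.ext h2]; exact hfy.trans hfx.symm
    · have hj' := joinedBy_of_isLink he' hab
      change f a = f b
      by_cases ha : joinedBy G F a x'
      · have hb : joinedBy G F b x' := (joinedBy G F).trans ((joinedBy G F).symm hj') ha
        simp only [f, if_pos ha, if_pos hb]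
      · have hb : ¬ joinedBy G F b x' := fun hb => ha ((joinedBy G F).trans hj' hb)
        simp only [f, if_neg ha, if_neg hb]
        exact Quotient.sound' hj'
  let g : Quotient (joinedBy G (insert e F)) → Quotient (joinedBy G F) :=
    Quotient.lift f hf
  have hsub : (Set.univ \ {Quotient.mk'' x'} : Set (Quotient (joinedBy G F))) ⊆ Set.range g := by
    intro q hq
    induction q using Quotient.inductionOn' with
    | h a =>
      refine ⟨Quotient.mk'' a, ?_⟩
      have ha : ¬ joinedBy G F a x' := fun h => hq.2 (Quotient.sound' h)
      exact if_neg ha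
  have h1 : (Set.univ \ {Quotient.mk'' x'} : Set (Quotient (joinedBy G F))).ncard + 1
      = Nat.card (Quotient (joinedBy G F)) := by
    rw [← Set.ncard_univ]
    exact Set.ncard_sdiff_singleton_add_one (Set.mem_univ _) (Set.toFinite _)
  have h2 := Set.ncard_le_ncard hsub (Set.toFinite _)
  have h3 : (Set.range g).ncard ≤ Nat.card (Quotient (joinedBy G (insert e F))) := by
    rw [← Set.image_univ, ← Set.ncard_univ]
    exact Set.ncard_image_le (Set.toFinite _)
  simp only [numNodesAfterContracting]
  omega

/-- An edge that joins two different components merges them. -/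
theorem numNodes_insert_of_not_joinedBy {G : Graph α β} {F : Set β} {e : β} {x y : V(G)}
    (hl : G.IsLink e x y) (h : ¬ joinedBy G F x y) :
    numNodesAfterContracting G (insert e F) + 1 = numNodesAfterContracting G F := by
  have h1 := numNodes_le_insert_add_one G F e
  have h2 : numNodesAfterContracting G (insert e F) < numNodesAfterContracting G F :=
    card_quotient_lt_of_le (joinedBy_mono (Set.subset_insert _ _))
      (joinedBy_of_isLink (Set.mem_insert _ _) hl) h
  omega

/-- Submodularity of the rank `|V| - numNodes`: adding `A` to a larger edge set merges at most
as many nodes as adding it to a smaller one. -/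
theorem numNodes_submodular (G : Graph α β) {X Y : Set β} (h : X ⊆ Y) (A : Finset β) :
    numNodesAfterContracting G Y + numNodesAfterContracting G (X ∪ A)
      ≤ numNodesAfterContracting G X + numNodesAfterContracting G (Y ∪ A) := by
  induction A using Finset.induction_on with
  | empty => simp [add_comm]
  | insert e A _ ih =>
    have step : ∀ X Y : Set β, X ⊆ Y →
        numNodesAfterContracting G Y + numNodesAfterContracting G (insert e X)
          ≤ numNodesAfterContracting G X + numNodesAfterContracting G (insert e Y) := by
      intro X Y hXY
      by_cases he : e ∈ E(G)
      swap
      · rw [numNodes_insert_of_notMem he, numNodes_insert_of_notMem he, add_comm]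
      obtain ⟨x, y, hl⟩ := exists_isLink_of_mem_edgeSet he
      have hl' : G.IsLink e (⟨x, hl.left_mem⟩ : V(G)) (⟨y, hl.right_mem⟩ : V(G)) := hl
      by_cases hj : joinedBy G X ⟨x, hl.left_mem⟩ ⟨y, hl.right_mem⟩
      · rw [numNodes_insert_of_joinedBy hl' hj,
          numNodes_insert_of_joinedBy hl' (joinedBy_mono hXY hj), add_comm]
      · have := numNodes_insert_of_not_joinedBy hl' hj
        have := numNodes_le_insert_add_one G Y e
        omega
    have := step (X ∪ A) (Y ∪ A) (Set.union_subset_union_left _ h)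
    rw [Finset.coe_insert, Set.union_insert, Set.union_insert]
    omega

theorem numNodes_le_union_add_card (G : Graph α β) (X : Set β) (A : Finset β) :
    numNodesAfterContracting G X ≤ numNodesAfterContracting G (X ∪ A) + A.card := by
  induction A using Finset.induction_on with
  | empty => simp
  | insert e A he ih =>
    have := numNodes_le_insert_add_one G (X ∪ A) e
    rw [Finset.coe_insert, Set.union_insert, Finset.card_insert_of_notMem he]
    omega

/-- If adding the edges `A` to `X` merges fewer than `|A|` pairs of nodes, some edge of `A` is
redundant. -/
theorem exists_redundant (G : Graph α β) {X : Set β} {A : Finset β}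
    (h : numNodesAfterContracting G X < numNodesAfterContracting G (X ∪ A) + A.card) :
    ∃ f ∈ A, numNodesAfterContracting G (X ∪ (A.erase f : Finset β))
      = numNodesAfterContracting G (X ∪ A) := by
  induction A using Finset.induction_on with
  | empty => simp at h
  | insert e A he ih =>
    by_cases h0 : numNodesAfterContracting G (X ∪ A)
        = numNodesAfterContracting G (X ∪ (insert e A : Finset β))
    · exact ⟨e, Finset.mem_insert_self _ _, by rwa [Finset.erase_insert he]⟩
    have h1 : numNodesAfterContracting G (X ∪ (insert e A : Finset β)) ≤
        numNodesAfterContracting G (X ∪ A) :=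
      numNodes_anti (Set.union_subset_union_right _ (by simp))
    rw [Finset.card_insert_of_notMem he] at h
    obtain ⟨f, hf, hfe⟩ := ih (by omega)
    refine ⟨f, Finset.mem_insert_of_mem hf, ?_⟩
    have hef : e ≠ f := fun h => he (h ▸ hf)
    have hsub := numNodes_submodular G (X := X ∪ (A.erase f : Finset β))
      (Y := X ∪ ((insert e A).erase f : Finset β))
      (Set.union_subset_union_right _ (by
        exact_mod_cast Finset.erase_subset_erase f (Finset.subset_insert e A))) {f}
    have e1 : X ∪ ((A.erase f : Finset β) : Set β) ∪ ((({f} : Finset β)) : Set β) = X ∪ A := by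
      rw [Set.union_assoc]; congr 1; ext z; by_cases hz : z = f <;> simp [hz, hf]
    have e2 : X ∪ (((insert e A).erase f : Finset β) : Set β) ∪ ((({f} : Finset β)) : Set β)
        = X ∪ (insert e A : Finset β) := by
      rw [Set.union_assoc]; congr 1; ext z; by_cases hz : z = f <;> simp [hz, hf]
    rw [e1, e2] at hsub
    have h2 : numNodesAfterContracting G (X ∪ (insert e A : Finset β)) ≤
        numNodesAfterContracting G (X ∪ ((insert e A).erase f : Finset β)) :=
      numNodes_anti (Set.union_subset_union_right _ (by
        exact_mod_cast Finset.erase_subset f (insert e A)))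
    omega

/-! ### Minimum spanning trees -/

omit [Finite α] in
theorem IsSpanningTree.numNodes_eq_one {G : Graph α β} {T : Finset β} (hV : V(G).Nonempty)
    (hT : IsSpanningTree G T) : numNodesAfterContracting G (T : Set β) = 1 :=
  (numNodes_eq_one_iff hV).2 hT.2.1

/-- A subset of a spanning tree is a forest. -/
theorem IsSpanningTree.numNodes_add_card {G : Graph α β} {T A : Finset β} (hV : V(G).Nonempty)
    (hT : IsSpanningTree G T) (hA : A ⊆ T) :
    numNodesAfterContracting G (A : Set β) + A.card = V(G).ncard := by
  have h1 := numNodes_le_union_add_card G ∅ A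
  have h2 := numNodes_le_union_add_card G A (T \ A)
  rw [numNodes_empty, Set.empty_union] at h1
  rw [← Finset.coe_union, Finset.union_sdiff_of_subset hA, hT.numNodes_eq_one hV,
    Finset.card_sdiff_of_subset hA] at h2
  have := Finset.card_le_card hA
  have := hT.2.2
  omega

/-- Kruskal's property: the edges of weight less than `x` of a minimum spanning tree connect
everything that is connected by edges of weight less than `x`. -/
theorem IsMinSpanningTree.joinedBy_lt_le {G : Graph α β} {w : β → ℝ} {T : Finset β}
    (hV : V(G).Nonempty) (hT : IsMinSpanningTree G w T) (x : ℝ) :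
    joinedBy G {e | w e < x} ≤ joinedBy G (T.filter fun e => w e < x : Finset β) := by
  refine joinedBy_le fun e he u v hl => ?_
  by_contra hj
  set A := T.filter fun e => w e < x with hA
  have hAT : A ⊆ T := Finset.filter_subset _ _
  have heT : e ∉ T := fun h =>
    hj (joinedBy_of_isLink (by simpa [hA] using ⟨h, he⟩) hl)
  have h1 := numNodes_insert_of_not_joinedBy hl hj
  have hcard := hT.1.numNodes_add_card hV hAT
  have hT1 := hT.1.numNodes_eq_one hV
  have hTc := hT.1.2.2
  have hun : (insert e (A : Set β)) ∪ ((T \ A : Finset β) : Set β) = insert e (T : Set β) := by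
    rw [Set.insert_union, ← Finset.coe_union, Finset.union_sdiff_of_subset hAT]
  have hone : numNodesAfterContracting G (insert e (T : Set β)) = 1 := by
    have := numNodes_anti (G := G) (Set.subset_insert e (T : Set β))
    have := numNodes_pos hV (insert e (T : Set β))
    omega
  -- `T + e` has a cycle through `e`, and some edge of weight at least `x` on it is redundant.
  obtain ⟨f, hf, hfe⟩ := exists_redundant G (X := insert e (A : Set β)) (A := T \ A) (by
    rw [hun, hone, Finset.card_sdiff_of_subset hAT]
    have := Finset.card_le_card hAT
    omega)
  rw [hun, hone] at hfe
  rw [Finset.mem_sdiff] at hf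
  have hwf : x ≤ w f := by
    by_contra hlt
    exact hf.2 (by simpa [hA] using ⟨hf.1, not_le.1 hlt⟩)
  have heT' : e ∉ T.erase f := fun h => heT (Finset.mem_of_mem_erase h)
  have hT' : IsSpanningTree G (insert e (T.erase f)) := by
    refine ⟨?_, ?_, ?_⟩
    · intro e' he'
      rcases Finset.mem_insert.1 he' with rfl | h
      · exact hl.edge_mem
      · exact hT.1.1 e' (Finset.mem_of_mem_erase h)
    · rw [← numNodes_eq_one_iff hV]
      have hle := numNodes_anti (G := G)
        (F := insert e (A : Set β) ∪ (((T \ A).erase f : Finset β) : Set β))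
        (F' := ((insert e (T.erase f) : Finset β) : Set β)) (by
          intro z hz
          rcases hz with (rfl | hz) | hz
          · simp
          · have : z ≠ f := fun h => hf.2 (h ▸ hz)
            simp [this, hAT hz]
          · simp only [Finset.coe_erase, Finset.coe_sdiff, Set.mem_sdiff, Finset.mem_coe,
              Set.mem_singleton_iff] at hz
            simp [hz.1.1, hz.2])
      have := numNodes_pos hV ((insert e (T.erase f) : Finset β) : Set β)
      omega
    · rw [Finset.card_insert_of_notMem heT', Finset.card_erase_add_one hf.1]
      exact hTc
  have hle := hT.2 _ hT'
  rw [Finset.sum_insert heT'] at hle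
  have := Finset.add_sum_erase T w hf.1
  have he' : w e < x := he
  linarith

theorem IsMinSpanningTree.numNodes_lt_eq {G : Graph α β} {w : β → ℝ} {T : Finset β}
    (hV : V(G).Nonempty) (hT : IsMinSpanningTree G w T) (x : ℝ) :
    numNodesAfterContracting G (T.filter fun e => w e < x : Finset β)
      = numNodesAfterContracting G {e | w e < x} :=
  le_antisymm (numNodes_le_of_le (hT.joinedBy_lt_le hV x))
    (numNodes_anti fun e he => by simp at he; exact he.2)

/-- A minimum spanning tree uses exactly as many edges of weight at least `x` as are needed to
connect the components of the lighter edges. -/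
theorem IsMinSpanningTree.card_ge_add_one {G : Graph α β} {w : β → ℝ} {T : Finset β}
    (hV : V(G).Nonempty) (hT : IsMinSpanningTree G w T) (x : ℝ) :
    (T.filter fun e => x ≤ w e).card + 1 = numNodesAfterContracting G {e | w e < x} := by
  have h1 := hT.1.numNodes_add_card hV (Finset.filter_subset (fun e => w e < x) T)
  rw [hT.numNodes_lt_eq hV] at h1
  have h2 := Finset.card_filter_add_card_filter_not (s := T) (fun e => w e < x)
  simp only [not_lt] at h2
  have := hT.1.2.2
  omega

end

section

open Classical

variable {α β : Type*} [Finite α] [Fintype β]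

/-! ### Principal edge sets -/

/-- The edge set of `G` as a finset. -/
def allEdges (G : Graph α β) : Finset β := Finset.univ.filter fun e => e ∈ E(G)

/-- `F` maximizes `|F| + π · (number of nodes after contracting F)`, that is, it minimizes
`π · rank F - |F|`. Then `F` is everywhere at least `π`-dense (relative to its subsets), and
contracting `F` leaves a graph that is everywhere at most `π`-dense. These are the sets of the
principal partition of the graphic matroid. -/
def IsPrincipal (G : Graph α β) (π : ℝ) (F : Finset β) : Prop :=
  F ⊆ allEdges G ∧ ∀ F' ⊆ allEdges G,
    (F'.card : ℝ) + π * numNodesAfterContracting G (F' : Set β)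
      ≤ F.card + π * numNodesAfterContracting G (F : Set β)

omit [Finite α] in
theorem exists_isPrincipal (G : Graph α β) (π : ℝ) : ∃ F, IsPrincipal G π F := by
  obtain ⟨F, hF, hmax⟩ := Finset.exists_max_image (allEdges G).powerset
    (fun F => (F.card : ℝ) + π * numNodesAfterContracting G (F : Set β))
    ⟨∅, Finset.empty_mem_powerset _⟩
  exact ⟨F, Finset.mem_powerset.1 hF, fun F' h => hmax F' (Finset.mem_powerset.2 h)⟩

omit [Finite α] in
theorem mem_allEdges {G : Graph α β} {e : β} : e ∈ allEdges G ↔ e ∈ E(G) := by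
  simp [allEdges]

omit [Finite α] in
theorem card_allEdges (G : Graph α β) : (allEdges G).card = E(G).ncard := by
  rw [← Set.ncard_coe_finset]; congr 1; ext e; simp [mem_allEdges]

/-- Inside a principal set, a minimum spanning tree uses at most a `1/π` fraction of the edges
above any weight threshold. -/
theorem IsPrincipal.mul_card_inter_ge_le {G : Graph α β} {π : ℝ} {F T : Finset β} {w : β → ℝ}
    (hV : V(G).Nonempty) (hπ : 0 ≤ π) (hF : IsPrincipal G π F) (hT : IsMinSpanningTree G w T)
    (x : ℝ) :
    π * ((T ∩ F).filter fun e => x ≤ w e).card ≤ ((F.filter fun e => x ≤ w e).card : ℝ) := by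
  set A := (T ∩ F).filter fun e => x ≤ w e with hA
  set B := T.filter fun e => w e < x with hB
  have hBT : B ⊆ T := Finset.filter_subset _ _
  have hAT : A ⊆ T := (Finset.filter_subset _ _).trans Finset.inter_subset_left
  have hdisj : Disjoint B A := by
    rw [Finset.disjoint_left]
    intro e h1 h2
    exact absurd (Finset.mem_filter.1 h1).2 (not_lt.2 (Finset.mem_filter.1 h2).2)
  -- `A` is independent over the lighter edges, as these are spanned by `B` and `B ∪ A ⊆ T`.
  have h1 := hT.1.numNodes_add_card hV hBT
  have h2 := hT.1.numNodes_add_card hV (Finset.union_subset hBT hAT)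
  rw [Finset.card_union_of_disjoint hdisj, Finset.coe_union] at h2
  have h3 := hT.numNodes_lt_eq hV x
  have h4 : numNodesAfterContracting G ({e | w e < x} ∪ (A : Set β)) ≤
      numNodesAfterContracting G ((B : Set β) ∪ A) :=
    numNodes_anti (Set.union_subset_union_left _ fun e he => (Finset.mem_filter.1 he).2)
  have h5 := numNodes_submodular G (X := ((F.filter fun e => w e < x : Finset β) : Set β))
    (Y := {e | w e < x}) (fun e he => (Finset.mem_filter.1 he).2) A
  have h6 : numNodesAfterContracting G (F : Set β) ≤ numNodesAfterContracting G
      (((F.filter fun e => w e < x : Finset β) : Set β) ∪ A) := by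
    apply numNodes_anti
    rw [← Finset.coe_union, Finset.coe_subset]
    exact Finset.union_subset (Finset.filter_subset _ _)
      ((Finset.filter_subset _ _).trans Finset.inter_subset_right)
  have h7 := hF.2 (F.filter fun e => w e < x) ((Finset.filter_subset _ _).trans hF.1)
  have h8 : numNodesAfterContracting G (F : Set β) + A.card ≤ numNodesAfterContracting G
      ((F.filter fun e => w e < x : Finset β) : Set β) := by
    rw [← hB] at h3
    omega
  have h9 := Finset.card_filter_add_card_filter_not (s := F) (fun e => w e < x)
  simp only [not_lt] at h9
  have h8' : (numNodesAfterContracting G (F : Set β) : ℝ) + A.card ≤ numNodesAfterContracting G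
      ((F.filter fun e => w e < x : Finset β) : Set β) := by exact_mod_cast h8
  have h9' : ((F.filter fun e => w e < x).card : ℝ) + (F.filter fun e => x ≤ w e).card = F.card :=
    by exact_mod_cast h9
  nlinarith

/-- Outside a principal set, a minimum spanning tree uses at least a `1/π` fraction of the edges
below any weight threshold. -/
theorem IsPrincipal.card_sdiff_lt_le {G : Graph α β} {π : ℝ} {F T : Finset β} {w : β → ℝ}
    (hV : V(G).Nonempty) (hπ : 0 ≤ π) (hF : IsPrincipal G π F) (hT : IsMinSpanningTree G w T)
    (x : ℝ) :
    (((allEdges G \ F).filter fun e => w e < x).card : ℝ)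
      ≤ π * ((T \ F).filter fun e => w e < x).card := by
  set A := (T \ F).filter fun e => w e < x with hA
  set D := (allEdges G \ F).filter fun e => w e < x with hD
  have hDE : D ⊆ allEdges G := (Finset.filter_subset _ _).trans Finset.sdiff_subset
  have hdisj : Disjoint F D := by
    rw [Finset.disjoint_left]
    intro e h1 h2
    exact (Finset.mem_sdiff.1 (Finset.mem_filter.1 h2).1).2 h1
  have h1 := hF.2 (F ∪ D) (Finset.union_subset hF.1 hDE)
  rw [Finset.card_union_of_disjoint hdisj] at h1
  have h2 := numNodes_le_union_add_card G (F : Set β) A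
  have h3 : numNodesAfterContracting G ((F : Set β) ∪ A) ≤
      numNodesAfterContracting G ((F ∪ D : Finset β) : Set β) := by
    apply numNodes_le_of_le
    refine joinedBy_le fun e he u v hl => ?_
    rcases Finset.mem_union.1 (Finset.mem_coe.1 he) with he | he
    · exact joinedBy_of_isLink (Or.inl he) hl
    · refine joinedBy_mono ?_ (hT.joinedBy_lt_le hV x
        (joinedBy_of_isLink (Finset.mem_filter.1 he).2 hl))
      intro z hz
      have hz := Finset.mem_filter.1 (Finset.mem_coe.1 hz)
      by_cases hzF : z ∈ F
      · exact Or.inl hzF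
      · exact Or.inr (by simp [hA, hz, hzF])
  have h4 : (numNodesAfterContracting G (F : Set β) : ℝ) ≤
      numNodesAfterContracting G ((F ∪ D : Finset β) : Set β) + A.card := by
    exact_mod_cast h2.trans (Nat.add_le_add_right h3 _)
  push_cast at h1 h4
  nlinarith

/-! ### Comparing sums layer by layer -/

omit [Fintype β] in
/-- If `A` has at most `r` times as many elements as `B` above every threshold of `L`, the same
comparison holds for the sums of any nonnegative increasing function of `L`. -/
theorem sum_le_mul_sum_of_card_filter_le {A B : Finset β} {L : β → ℕ} {g : ℕ → ℝ} {r : ℝ}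
    (hg0 : 0 ≤ g 0) (hg : Monotone g)
    (h : ∀ x, ((A.filter fun e => x ≤ L e).card : ℝ) ≤ r * (B.filter fun e => x ≤ L e).card) :
    ∑ e ∈ A, g (L e) ≤ r * ∑ e ∈ B, g (L e) := by
  obtain ⟨M, hM⟩ : ∃ M, ∀ e ∈ A ∪ B, L e ≤ M :=
    ⟨(A ∪ B).sup L, fun e he => Finset.le_sup he⟩
  let d : ℕ → ℝ := fun x => g x - if x = 0 then 0 else g (x - 1)
  have hd : ∀ x, 0 ≤ d x := by
    intro x
    rcases Nat.eq_zero_or_pos x with rfl | hx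
    · simpa [d] using hg0
    · simp only [d, if_neg hx.ne']
      exact sub_nonneg.2 (hg (Nat.sub_le _ _))
  have hsum : ∀ k, ∑ x ∈ Finset.range (k + 1), d x = g k := by
    intro k
    induction k with
    | zero => simp [d]
    | succ k ih => rw [Finset.sum_range_succ, ih]; simp [d]
  have key : ∀ S ⊆ A ∪ B, ∑ e ∈ S, g (L e)
      = ∑ x ∈ Finset.range (M + 1), d x * (S.filter fun e => x ≤ L e).card := by
    intro S hS
    have h1 : ∀ e ∈ S, g (L e) = ∑ x ∈ Finset.range (M + 1), if x ≤ L e then d x else 0 := by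
      intro e he
      rw [← hsum, ← Finset.sum_filter]
      congr 1
      ext x
      have := hM e (hS he)
      simp only [Finset.mem_range, Finset.mem_filter]
      omega
    rw [Finset.sum_congr rfl h1, Finset.sum_comm]
    refine Finset.sum_congr rfl fun x _ => ?_
    rw [← Finset.sum_filter, Finset.sum_const, nsmul_eq_mul, mul_comm]
  rw [key A Finset.subset_union_left, key B Finset.subset_union_right, Finset.mul_sum]
  refine Finset.sum_le_sum fun x _ => ?_
  have := mul_le_mul_of_nonneg_left (h x) (hd x)
  linarith

omit [Fintype β] in
theorem sum_le_mul_sum_of_card_filter_lt {A B : Finset β} {L : β → ℕ} {g : ℕ → ℝ} {r : ℝ}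
    (hr : 0 ≤ r) (hg0 : ∀ x, 0 ≤ g x) (hg : Antitone g)
    (h : ∀ x : ℕ, ((A.filter fun e => L e < x).card : ℝ) ≤ r * (B.filter fun e => L e < x).card) :
    ∑ e ∈ A, g (L e) ≤ r * ∑ e ∈ B, g (L e) := by
  obtain ⟨M, hM⟩ : ∃ M, ∀ e ∈ A ∪ B, L e ≤ M :=
    ⟨(A ∪ B).sup L, fun e he => Finset.le_sup he⟩
  have key := sum_le_mul_sum_of_card_filter_le (A := A) (B := B) (L := fun e => M - L e)
    (g := fun x => g (M - x)) (r := r) (hg0 _) (fun x y hxy => hg (by omega)) (by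
      intro x
      rcases le_or_gt x M with hx | hx
      · have e1 : ∀ S ⊆ A ∪ B, (S.filter fun e => x ≤ M - L e)
            = S.filter fun e => L e < M - x + 1 := by
          intro S hS
          refine Finset.filter_congr fun e he => ?_
          have := hM e (hS he)
          omega
        rw [e1 A Finset.subset_union_left, e1 B Finset.subset_union_right]
        exact h _
      · rw [Finset.filter_false_of_mem fun e _ => by omega]
        simpa using mul_nonneg hr (Nat.cast_nonneg _))
  have e2 : ∀ S ⊆ A ∪ B, ∑ e ∈ S, g (M - (M - L e)) = ∑ e ∈ S, g (L e) := by
    intro S hS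
    refine Finset.sum_congr rfl fun e he => ?_
    rw [Nat.sub_sub_self (hM e (hS he))]
  rwa [e2 A Finset.subset_union_left, e2 B Finset.subset_union_right] at key

/-! ### Loads of a greedy tree packing -/

/-- The number of trees among the first `t` that contain `e`. -/
def useCount (T : ℕ → Finset β) (t : ℕ) (e : β) : ℕ := ((Finset.range t).filter (e ∈ T ·)).card

omit [Fintype β] in
theorem useCount_succ (T : ℕ → Finset β) (t : ℕ) (e : β) :
    useCount T (t + 1) e = useCount T t e + if e ∈ T t then 1 else 0 := by
  rw [useCount, Finset.range_add_one, Finset.filter_insert]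
  split_ifs with h
  · rw [Finset.card_insert_of_notMem (by simp)]; rfl
  · rfl

omit [Fintype β] in
theorem useCount_eq_sum (T : ℕ → Finset β) (t : ℕ) (e : β) :
    useCount T t e = ∑ j ∈ Finset.range t, if e ∈ T j then 1 else 0 := by
  rw [useCount, Finset.card_filter]

omit [Fintype β] in
theorem load_eq_useCount_div (T : ℕ → Finset β) (t : ℕ) (e : β) :
    load (fun j : Fin t => T j) e = useCount T t e / t := by
  rw [load, useCount_eq_sum, Finset.card_filter,
    Fin.sum_univ_eq_sum_range (fun j => if e ∈ T j then 1 else 0)]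

omit [Fintype β] in
theorem load_latterHalf (T : ℕ → Finset β) (R : ℕ) (e : β) :
    load (latterHalf T R) e = ((useCount T (2 * R) e : ℝ) - useCount T R e) / R := by
  have h : useCount T (2 * R) e = useCount T R e
      + (Finset.univ.filter fun j : Fin R => e ∈ latterHalf T R j).card := by
    rw [useCount_eq_sum, useCount_eq_sum, two_mul, Finset.sum_range_add, Finset.card_filter,
      ← Fin.sum_univ_eq_sum_range (fun j => if e ∈ T (R + j) then 1 else 0)]
    rfl
  rw [load, h]
  push_cast
  ring

omit [Finite α] [Fintype β] in
theorem IsGreedyTreePacking.isMinSpanningTree_useCount {G : Graph α β} {k : ℕ}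
    {T : ℕ → Finset β} (hT : IsGreedyTreePacking G k T) {t : ℕ} (ht : t < k) :
    IsMinSpanningTree G (fun e => (useCount T t e : ℝ)) (T t) := by
  refine ⟨(hT t ht).1, fun T' hT' => ?_⟩
  have h := (hT t ht).2 T' hT'
  simp only [load_eq_useCount_div, ← Finset.sum_div] at h
  rcases Nat.eq_zero_or_pos t with rfl | hpos
  · simp [useCount]
  · exact (div_le_div_iff_of_pos_right (by exact_mod_cast hpos)).1 h

/-- The exponential potential of a principal set grows at most by a factor `1 + η / π` per
round. -/
theorem IsGreedyTreePacking.sum_pow_useCount_le {G : Graph α β} {k : ℕ} {T : ℕ → Finset β}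
    (hV : V(G).Nonempty) (hT : IsGreedyTreePacking G k T) {π : ℝ} {F : Finset β} (hπ : 0 < π)
    (hF : IsPrincipal G π F) {η : ℝ} (hη : 0 ≤ η) (t : ℕ) (ht : t ≤ k) :
    ∑ e ∈ F, (1 + η) ^ useCount T t e ≤ (allEdges G).card * Real.exp (η * t / π) := by
  induction t with
  | zero => simpa [useCount] using Finset.card_le_card hF.1
  | succ t ih =>
    have ih := ih (by omega)
    have hM := hT.isMinSpanningTree_useCount (t := t) (by omega)
    have hstep : ∑ e ∈ T t ∩ F, (1 + η) ^ useCount T t e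
        ≤ 1 / π * ∑ e ∈ F, (1 + η) ^ useCount T t e := by
      refine sum_le_mul_sum_of_card_filter_le (g := fun x => (1 + η) ^ x) (by simp)
        (fun x y hxy => pow_le_pow_right₀ (by linarith) hxy) fun x => ?_
      have := hF.mul_card_inter_ge_le hV hπ.le hM x
      simp only [Nat.cast_le] at this
      rw [div_mul_eq_mul_div, one_mul, le_div_iff₀ hπ, mul_comm]
      exact this
    have hsplit : ∑ e ∈ F, (1 + η) ^ useCount T (t + 1) e
        = ∑ e ∈ F, (1 + η) ^ useCount T t e + η * ∑ e ∈ T t ∩ F, (1 + η) ^ useCount T t e := by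
      rw [Finset.inter_comm, ← Finset.filter_mem_eq_inter, Finset.sum_filter, Finset.mul_sum,
        ← Finset.sum_add_distrib]
      refine Finset.sum_congr rfl fun e _ => ?_
      rw [useCount_succ]
      split_ifs <;> ring
    have hexp : Real.exp (η * ((t + 1 : ℕ) : ℝ) / π)
        = Real.exp (η * t / π) * Real.exp (η / π) := by
      rw [← Real.exp_add]; congr 1; push_cast; ring
    have h0 : 0 ≤ ∑ e ∈ F, (1 + η) ^ useCount T t e :=
      Finset.sum_nonneg fun e _ => pow_nonneg (by linarith) _
    have h1 : 1 + η / π ≤ Real.exp (η / π) := by linarith [Real.add_one_le_exp (η / π)]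
    calc ∑ e ∈ F, (1 + η) ^ useCount T (t + 1) e
        ≤ (∑ e ∈ F, (1 + η) ^ useCount T t e) * (1 + η / π) := by
          rw [hsplit]
          have := mul_le_mul_of_nonneg_left hstep hη
          calc _ ≤ _ + η * (1 / π * ∑ e ∈ F, (1 + η) ^ useCount T t e) := by gcongr
            _ = _ := by ring
      _ ≤ (∑ e ∈ F, (1 + η) ^ useCount T t e) * Real.exp (η / π) := by gcongr
      _ ≤ _ := by
          rw [hexp, ← mul_assoc]
          exact mul_le_mul_of_nonneg_right ih (Real.exp_pos _).le

/-- The decaying potential of the complement of a principal set shrinks at least by a factor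
`1 - η / π` per round. -/
theorem IsGreedyTreePacking.sum_pow_useCount_sdiff_le {G : Graph α β} {k : ℕ}
    {T : ℕ → Finset β} (hV : V(G).Nonempty) (hT : IsGreedyTreePacking G k T) {π : ℝ}
    {F : Finset β} (hπ : 0 < π) (hF : IsPrincipal G π F) {η : ℝ} (hη : 0 ≤ η) (hη1 : η ≤ 1)
    (t : ℕ) (ht : t ≤ k) :
    ∑ e ∈ allEdges G \ F, (1 - η) ^ useCount T t e
      ≤ (allEdges G).card * Real.exp (-(η * t / π)) := by
  induction t with
  | zero => simpa [useCount] using Finset.card_le_card (Finset.sdiff_subset (s := allEdges G))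
  | succ t ih =>
    have ih := ih (by omega)
    have hM := hT.isMinSpanningTree_useCount (t := t) (by omega)
    have hstep : ∑ e ∈ allEdges G \ F, (1 - η) ^ useCount T t e
        ≤ π * ∑ e ∈ T t \ F, (1 - η) ^ useCount T t e := by
      refine sum_le_mul_sum_of_card_filter_lt (g := fun x => (1 - η) ^ x) hπ.le
        (fun x => pow_nonneg (by linarith) _)
        (fun x y hxy => pow_le_pow_of_le_one (by linarith) (by linarith) hxy) fun x => ?_
      have := hF.card_sdiff_lt_le hV hπ.le hM x
      simp only [Nat.cast_lt] at this
      exact this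
    have hTE : T t \ F = (allEdges G \ F).filter (· ∈ T t) := by
      ext e
      have := hM.1.1 e
      simp only [Finset.mem_sdiff, Finset.mem_filter, mem_allEdges]
      tauto
    have hsplit : ∑ e ∈ allEdges G \ F, (1 - η) ^ useCount T (t + 1) e
        = ∑ e ∈ allEdges G \ F, (1 - η) ^ useCount T t e
          - η * ∑ e ∈ T t \ F, (1 - η) ^ useCount T t e := by
      rw [hTE, Finset.sum_filter, Finset.mul_sum, ← Finset.sum_sub_distrib]
      refine Finset.sum_congr rfl fun e _ => ?_
      rw [useCount_succ]
      split_ifs <;> ring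
    have hexp : Real.exp (-(η * ((t + 1 : ℕ) : ℝ) / π))
        = Real.exp (-(η * t / π)) * Real.exp (-(η / π)) := by
      rw [← Real.exp_add]; congr 1; push_cast; ring
    have h0 : 0 ≤ ∑ e ∈ allEdges G \ F, (1 - η) ^ useCount T t e :=
      Finset.sum_nonneg fun e _ => pow_nonneg (by linarith) _
    have h1 : 1 - η / π ≤ Real.exp (-(η / π)) := by linarith [Real.add_one_le_exp (-(η / π))]
    calc ∑ e ∈ allEdges G \ F, (1 - η) ^ useCount T (t + 1) e
        ≤ (∑ e ∈ allEdges G \ F, (1 - η) ^ useCount T t e) * (1 - η / π) := by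
          rw [hsplit]
          have h2 : η / π * ∑ e ∈ allEdges G \ F, (1 - η) ^ useCount T t e
              ≤ η * ∑ e ∈ T t \ F, (1 - η) ^ useCount T t e := by
            rw [div_mul_eq_mul_div, div_le_iff₀ hπ, mul_assoc]
            exact mul_le_mul_of_nonneg_left (by linarith) hη
          linarith
      _ ≤ (∑ e ∈ allEdges G \ F, (1 - η) ^ useCount T t e) * Real.exp (-(η / π)) := by gcongr
      _ ≤ _ := by
          rw [hexp, ← mul_assoc]
          exact mul_le_mul_of_nonneg_right ih (Real.exp_pos _).le

end

section

open Classical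

variable {α β : Type*} [Finite α] [Fintype β]

/-- If `36 π log m ≤ t γ²`, an edge of a principal set has load at most `(1 + γ) / π` after `t`
rounds. -/
theorem IsGreedyTreePacking.useCount_le {G : Graph α β} {k : ℕ} {T : ℕ → Finset β}
    (hV : V(G).Nonempty) (hT : IsGreedyTreePacking G k T) {π : ℝ} {F : Finset β} (hπ : 0 < π)
    (hF : IsPrincipal G π F) {γ : ℝ} (hγ : 0 < γ) (hγ1 : γ ≤ 1) {t : ℕ} (ht : t ≤ k)
    (htγ : 36 * π * Real.log E(G).ncard ≤ t * γ ^ 2) {e : β} (he : e ∈ F) :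
    (useCount T t e : ℝ) ≤ (1 + γ) * t / π := by
  set η : ℝ := γ / 3 with hηdef
  have hη : 0 < η := by positivity
  have hm : 0 < (allEdges G).card := Finset.card_pos.2 ⟨e, hF.1 he⟩
  have h1 : (1 + η) ^ useCount T t e ≤ (allEdges G).card * Real.exp (η * t / π) :=
    (Finset.single_le_sum (f := fun e => (1 + η) ^ useCount T t e)
      (fun i _ => pow_nonneg (by linarith) _) he).trans
      (hT.sum_pow_useCount_le hV hπ hF hη.le t ht)
  have h2 := Real.log_le_log (by positivity) h1
  rw [Real.log_pow, Real.log_mul (by positivity) (Real.exp_pos _).ne', Real.log_exp,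
    card_allEdges] at h2
  have h3 : η / (1 + η) ≤ Real.log (1 + η) := by
    have := Real.one_sub_inv_le_log_of_pos (x := 1 + η) (by positivity)
    have e1 : 1 - (1 + η)⁻¹ = η / (1 + η) := by field_simp; ring
    linarith
  have h4 : (useCount T t e : ℝ) * (η / (1 + η)) ≤ Real.log E(G).ncard + η * t / π :=
    (mul_le_mul_of_nonneg_left h3 (Nat.cast_nonneg _)).trans h2
  have h5 : Real.log E(G).ncard ≤ t * γ ^ 2 / (36 * π) := by
    rw [le_div_iff₀ (by positivity)]; linarith
  have h6 : (useCount T t e : ℝ) * (η / (1 + η)) ≤ (t / π) * (γ ^ 2 / 36 + η) := by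
    calc _ ≤ _ := h4
      _ ≤ t * γ ^ 2 / (36 * π) + η * t / π := by gcongr
      _ = _ := by field_simp
  have h7 : (useCount T t e : ℝ) ≤ (t / π) * ((γ ^ 2 / 36 + η) * ((1 + η) / η)) := by
    calc (useCount T t e : ℝ) = (useCount T t e : ℝ) * (η / (1 + η)) * ((1 + η) / η) := by
          field_simp
      _ ≤ (t / π) * (γ ^ 2 / 36 + η) * ((1 + η) / η) := by gcongr
      _ = _ := by ring
  have h8 : (γ ^ 2 / 36 + η) * ((1 + η) / η) ≤ 1 + γ := by
    have : (γ ^ 2 / 36 + η) * ((1 + η) / η) = (1 + γ / 12) * (1 + γ / 3) := by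
      rw [hηdef]; field_simp; ring
    rw [this]; nlinarith
  calc _ ≤ _ := h7
    _ ≤ (t / π) * (1 + γ) := by gcongr
    _ = _ := by ring

/-- If `36 π log m ≤ t γ²`, an edge outside a principal set has load at least `(1 - γ) / π` after
`t` rounds. -/
theorem IsGreedyTreePacking.le_useCount {G : Graph α β} {k : ℕ} {T : ℕ → Finset β}
    (hV : V(G).Nonempty) (hT : IsGreedyTreePacking G k T) {π : ℝ} {F : Finset β} (hπ : 0 < π)
    (hF : IsPrincipal G π F) {γ : ℝ} (hγ : 0 < γ) (hγ1 : γ ≤ 1) {t : ℕ} (ht : t ≤ k)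
    (htγ : 36 * π * Real.log E(G).ncard ≤ t * γ ^ 2) {e : β} (heG : e ∈ E(G)) (he : e ∉ F) :
    (1 - γ) * t / π ≤ (useCount T t e : ℝ) := by
  set η : ℝ := γ / 3 with hηdef
  have hη : 0 < η := by positivity
  have hη1 : 0 < 1 - η := by rw [hηdef]; linarith
  have he' : e ∈ allEdges G \ F := Finset.mem_sdiff.2 ⟨mem_allEdges.2 heG, he⟩
  have hm : 0 < (allEdges G).card := Finset.card_pos.2 ⟨e, mem_allEdges.2 heG⟩
  have h1 : (1 - η) ^ useCount T t e ≤ (allEdges G).card * Real.exp (-(η * t / π)) :=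
    (Finset.single_le_sum (f := fun e => (1 - η) ^ useCount T t e)
      (fun i _ => pow_nonneg hη1.le _) he').trans
      (hT.sum_pow_useCount_sdiff_le hV hπ hF hη.le (by linarith) t ht)
  have h2 := Real.log_le_log (by positivity) h1
  rw [Real.log_pow, Real.log_mul (by positivity) (Real.exp_pos _).ne', Real.log_exp,
    card_allEdges] at h2
  have h3 : -(η / (1 - η)) ≤ Real.log (1 - η) := by
    have := Real.one_sub_inv_le_log_of_pos hη1
    have e1 : 1 - (1 - η)⁻¹ = -(η / (1 - η)) := by field_simp; ring
    linarith
  have h4 : η * t / π - Real.log E(G).ncard ≤ (useCount T t e : ℝ) * (η / (1 - η)) := by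
    have := mul_le_mul_of_nonneg_left h3 (Nat.cast_nonneg (α := ℝ) (useCount T t e))
    linarith
  have h5 : Real.log E(G).ncard ≤ t * γ ^ 2 / (36 * π) := by
    rw [le_div_iff₀ (by positivity)]; linarith
  have h6 : (t / π) * (η - γ ^ 2 / 36) ≤ (useCount T t e : ℝ) * (η / (1 - η)) := by
    calc _ = η * t / π - t * γ ^ 2 / (36 * π) := by field_simp
      _ ≤ η * t / π - Real.log E(G).ncard := by gcongr
      _ ≤ _ := h4
  have h7 : (t / π) * ((η - γ ^ 2 / 36) * ((1 - η) / η)) ≤ (useCount T t e : ℝ) := by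
    calc _ = (t / π) * (η - γ ^ 2 / 36) * ((1 - η) / η) := by ring
      _ ≤ (useCount T t e : ℝ) * (η / (1 - η)) * ((1 - η) / η) := by gcongr
      _ = _ := by field_simp
  have h8 : 1 - γ ≤ (η - γ ^ 2 / 36) * ((1 - η) / η) := by
    have : (η - γ ^ 2 / 36) * ((1 - η) / η) = (1 - γ / 12) * (1 - γ / 3) := by
      rw [hηdef]; field_simp; ring
    rw [this]; nlinarith
  calc _ = (t / π) * (1 - γ) := by ring
    _ ≤ (t / π) * ((η - γ ^ 2 / 36) * ((1 - η) / η)) := by gcongr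
    _ ≤ _ := h7

/-! ### Cuts and components -/

omit [Finite α] in
theorem mem_cutEdges {G : Graph α β} {A : Set α} {e : β} :
    e ∈ cutEdges G A ↔ ∃ x ∈ A, ∃ y ∉ A, G.IsLink e x y := by
  simp [cutEdges]

omit [Finite α] in
theorem mem_cutEdges_iff_of_isLink {G : Graph α β} {A : Set α} {e : β} {x y : α}
    (h : G.IsLink e x y) : e ∈ cutEdges G A ↔ ¬ (x ∈ A ↔ y ∈ A) := by
  rw [mem_cutEdges]
  constructor
  · rintro ⟨u, hu, v, hv, huv⟩
    rcases h.eq_and_eq_or_eq_and_eq huv with ⟨rfl, rfl⟩ | ⟨rfl, rfl⟩ <;> tauto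
  · intro hA
    by_cases hx : x ∈ A
    · exact ⟨x, hx, y, by tauto, h⟩
    · exact ⟨y, by tauto, x, hx, h.symm⟩

omit [Finite α] in
theorem mem_cuts {G : Graph α β} {C : Finset β} :
    C ∈ cuts G ↔ ∃ A ⊆ V(G), A.Nonempty ∧ A ≠ V(G) ∧ C = cutEdges G A := by
  simp [cuts]

omit [Finite α] in
/-- A connecting edge set crosses every cut. -/
theorem exists_mem_cutEdges {G : Graph α β} {F : Set β} (hF : Connects G F) {A : Set α}
    (hA : A ⊆ V(G)) (hne : A.Nonempty) (hAV : A ≠ V(G)) : ∃ e ∈ F, e ∈ cutEdges G A := by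
  by_contra! hno
  obtain ⟨x, hx⟩ := hne
  obtain ⟨y, hy, hyA⟩ := Set.exists_of_ssubset (hA.ssubset_of_ne hAV)
  have := iff_of_joinedBy (P := (· ∈ A)) (fun e he u v hl => by
    have := (mem_cutEdges_iff_of_isLink (A := A) hl).not.1 (hno e he)
    tauto) (hF ⟨x, hA hx⟩ ⟨y, hy⟩)
  exact hyA (this.1 hx)

omit [Finite α] in
theorem minCut_le_card {G : Graph α β} {C : Finset β} (hC : C ∈ cuts G) :
    minCut G ≤ C.card :=
  Nat.sInf_le ⟨C, hC, rfl⟩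

omit [Finite α] in
theorem cuts_nonempty {G : Graph α β} (h2 : 2 ≤ V(G).ncard) : (cuts G).Nonempty := by
  obtain ⟨x, hx, y, hy, hxy⟩ := (Set.one_lt_ncard (Set.finite_of_ncard_ne_zero (by omega))).1
    (show 1 < V(G).ncard by omega)
  refine ⟨_, mem_cuts.2 ⟨{x}, by simpa using hx, Set.singleton_nonempty x, ?_, rfl⟩⟩
  intro h
  rw [← h] at hy
  exact hxy hy.symm

omit [Finite α] in
theorem exists_card_eq_minCut {G : Graph α β} (h2 : 2 ≤ V(G).ncard) :
    ∃ C ∈ cuts G, C.card = minCut G := by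
  obtain ⟨C, hC⟩ := cuts_nonempty h2
  exact Nat.sInf_mem (s := {k | ∃ C ∈ cuts G, C.card = k}) ⟨_, C, hC, rfl⟩

omit [Finite α] in
theorem minCut_pos {G : Graph α β} (h2 : 2 ≤ V(G).ncard) (hG : Connects G E(G)) :
    0 < minCut G := by
  obtain ⟨C, hC, h⟩ := exists_card_eq_minCut h2
  obtain ⟨A, hA, hne, hAV, rfl⟩ := mem_cuts.1 hC
  obtain ⟨e, -, he⟩ := exists_mem_cutEdges hG hA hne hAV
  rw [← h]
  exact Finset.card_pos.2 ⟨e, he⟩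

/-- The vertex set of a node of the graph obtained by contracting `F`. -/
def nodeSet {G : Graph α β} {F : Set β} (q : Quotient (joinedBy G F)) : Set α :=
  {a | ∃ h : a ∈ V(G), (Quotient.mk'' ⟨a, h⟩ : Quotient (joinedBy G F)) = q}

omit [Finite α] [Fintype β] in
theorem mem_nodeSet {G : Graph α β} {F : Set β} {q : Quotient (joinedBy G F)} {a : α}
    (h : a ∈ V(G)) : a ∈ nodeSet q ↔ (Quotient.mk'' ⟨a, h⟩ : Quotient (joinedBy G F)) = q :=
  ⟨fun ⟨_, h⟩ => h, fun h' => ⟨h, h'⟩⟩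

omit [Finite α] [Fintype β] in
theorem nodeSet_subset {G : Graph α β} {F : Set β} (q : Quotient (joinedBy G F)) :
    nodeSet q ⊆ V(G) := fun _ h => h.1

omit [Finite α] [Fintype β] in
theorem nodeSet_nonempty {G : Graph α β} {F : Set β} (q : Quotient (joinedBy G F)) :
    (nodeSet q).Nonempty := by
  induction q using Quotient.inductionOn' with
  | h a => exact ⟨a, a.2, rfl⟩

omit [Finite α] in
theorem cutEdges_nodeSet_mem_cuts {G : Graph α β} {F : Set β}
    {q q' : Quotient (joinedBy G F)} (hq : q ≠ q') : cutEdges G (nodeSet q) ∈ cuts G := by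
  refine mem_cuts.2 ⟨_, nodeSet_subset q, nodeSet_nonempty q, fun h => ?_, rfl⟩
  obtain ⟨a, ha⟩ := nodeSet_nonempty q'
  have ha' : a ∈ nodeSet q := h ▸ nodeSet_subset q' ha
  exact hq (((mem_nodeSet ha.1).1 ha').symm.trans ((mem_nodeSet ha.1).1 ha))

omit [Finite α] in
/-- The degrees of the nodes after contracting `F` sum to at most twice the number of the
remaining edges. -/
theorem sum_card_cutEdges_nodeSet_le {G : Graph α β} (F : Finset β)
    [Fintype (Quotient (joinedBy G (F : Set β)))] :
    ∑ q : Quotient (joinedBy G (F : Set β)), (cutEdges G (nodeSet q)).card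
      ≤ 2 * (allEdges G \ F).card := by
  have hsub : ∀ q : Quotient (joinedBy G (F : Set β)),
      cutEdges G (nodeSet q) = (allEdges G \ F).filter fun e => e ∈ cutEdges G (nodeSet q) := by
    intro q
    ext e
    simp only [Finset.mem_filter, Finset.mem_sdiff, mem_allEdges, iff_and_self]
    intro he
    obtain ⟨x, hx, y, hy, hl⟩ := mem_cutEdges.1 he
    refine ⟨hl.edge_mem, fun heF => hy ?_⟩
    have hl' : G.IsLink e (⟨x, hl.left_mem⟩ : V(G)) (⟨y, hl.right_mem⟩ : V(G)) := hl
    rw [mem_nodeSet hl.right_mem, ← (mem_nodeSet hl.left_mem).1 hx]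
    exact Quotient.sound' ((joinedBy G (F : Set β)).symm
      (joinedBy_of_isLink (Finset.mem_coe.2 heF) hl'))
  calc ∑ q : Quotient (joinedBy G (F : Set β)), (cutEdges G (nodeSet q)).card
      = ∑ q : Quotient (joinedBy G (F : Set β)), ∑ e ∈ allEdges G \ F,
          if e ∈ cutEdges G (nodeSet q) then 1 else 0 := by
        refine Finset.sum_congr rfl fun q _ => ?_
        rw [← Finset.card_filter, ← hsub]
    _ = ∑ e ∈ allEdges G \ F, (Finset.univ.filter fun q : Quotient (joinedBy G (F : Set β)) =>
          e ∈ cutEdges G (nodeSet q)).card := by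
        rw [Finset.sum_comm]
        exact Finset.sum_congr rfl fun e _ => (Finset.card_filter _ _).symm
    _ ≤ ∑ e ∈ allEdges G \ F, 2 := by
        refine Finset.sum_le_sum fun e he => ?_
        obtain ⟨x, y, hl⟩ := exists_isLink_of_mem_edgeSet
          (mem_allEdges.1 (Finset.mem_sdiff.1 he).1)
        refine (Finset.card_le_card (t := {Quotient.mk'' ⟨x, hl.left_mem⟩,
          Quotient.mk'' ⟨y, hl.right_mem⟩}) fun q hq => ?_).trans Finset.card_le_two
        have hq := (mem_cutEdges_iff_of_isLink hl).1 (Finset.mem_filter.1 hq).2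
        rw [mem_nodeSet hl.left_mem, mem_nodeSet hl.right_mem] at hq
        rw [Finset.mem_insert, Finset.mem_singleton, eq_comm, @eq_comm _ q]
        tauto
    _ = _ := by rw [Finset.sum_const, smul_eq_mul, mul_comm]

/-! ### Principal sets in the extreme ranges -/

omit [Finite α] in
theorem connects_allEdges {G : Graph α β} (hV : V(G).Nonempty) (hG : Connects G E(G)) :
    numNodesAfterContracting G (allEdges G : Set β) = 1 := by
  rw [show ((allEdges G : Finset β) : Set β) = E(G) by ext e; simp [mem_allEdges]]
  exact (numNodes_eq_one_iff hV).2 hG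

omit [Finite α] in
/-- Contracting a principal set leaves at most `π (k - 1)` edges, where `k` is the number of
nodes. -/
theorem IsPrincipal.card_sdiff_le {G : Graph α β} {π : ℝ} {F : Finset β} (hV : V(G).Nonempty)
    (hG : Connects G E(G)) (hF : IsPrincipal G π F) :
    ((allEdges G \ F).card : ℝ) ≤ π * (numNodesAfterContracting G (F : Set β) - 1) := by
  have h := hF.2 _ subset_rfl
  rw [connects_allEdges hV hG] at h
  have h2 : (allEdges G \ F).card + F.card = (allEdges G).card :=
    Finset.card_sdiff_add_card_eq_card hF.1
  have h2' : ((allEdges G \ F).card : ℝ) + F.card = (allEdges G).card := by exact_mod_cast h2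
  push_cast at h
  linarith

/-- For `π ≤ λ / 2` everything is dense. -/
theorem IsPrincipal.eq_allEdges {G : Graph α β} {π : ℝ} {F : Finset β} (hV : V(G).Nonempty)
    (hG : Connects G E(G)) (hπ : 0 < π) (hπ2 : 2 * π ≤ minCut G) (hF : IsPrincipal G π F) :
    F = allEdges G := by
  have h1 := hF.card_sdiff_le hV hG
  have hpos := numNodes_pos hV (F : Set β)
  by_cases h2 : numNodesAfterContracting G (F : Set β) = 1
  · rw [h2] at h1
    simp only [Nat.cast_one, sub_self, mul_zero] at h1
    have h3 : (allEdges G \ F).card = 0 := by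
      have : 0 ≤ ((allEdges G \ F).card : ℝ) := Nat.cast_nonneg _
      exact_mod_cast le_antisymm h1 this
    exact subset_antisymm hF.1 (Finset.sdiff_eq_empty_iff_subset.1 (Finset.card_eq_zero.1 h3))
  · exfalso
    let _ : Fintype (Quotient (joinedBy G (F : Set β))) := Fintype.ofFinite _
    have hcard : numNodesAfterContracting G (F : Set β)
        = Fintype.card (Quotient (joinedBy G (F : Set β))) := Nat.card_eq_fintype_card
    have hdeg : ∀ q : Quotient (joinedBy G (F : Set β)),
        minCut G ≤ (cutEdges G (nodeSet q)).card := by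
      intro q
      obtain ⟨q', hq'⟩ := Fintype.exists_ne_of_one_lt_card (by omega) q
      exact minCut_le_card (cutEdges_nodeSet_mem_cuts hq'.symm)
    have h3 := Finset.sum_le_sum fun q (_ : q ∈ Finset.univ) => hdeg q
    rw [Finset.sum_const, smul_eq_mul, Finset.card_univ, ← hcard] at h3
    have h4 := h3.trans (sum_card_cutEdges_nodeSet_le F)
    have h4' : (numNodesAfterContracting G (F : Set β) : ℝ) * minCut G
        ≤ 2 * (allEdges G \ F).card := by exact_mod_cast h4
    have h5 := mul_le_mul_of_nonneg_left hπ2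
      (Nat.cast_nonneg (α := ℝ) (numNodesAfterContracting G (F : Set β)))
    linarith

/-- If the `k`-strong components are trivial, a principal set with `π ≥ k` consists of loops. -/
theorem IsPrincipal.eq_of_isLink {G : Graph α β} {π : ℝ} {F : Finset β} {k : ℕ} (hk : k ≤ π)
    (hS : StrongComponentsTrivial G k) (hF : IsPrincipal G π F) {e : β} (he : e ∈ F) {x y : α}
    (hl : G.IsLink e x y) : x = y := by
  have hl' : G.IsLink e (⟨x, hl.left_mem⟩ : V(G)) (⟨y, hl.right_mem⟩ : V(G)) := hl
  set q : Quotient (joinedBy G (F : Set β)) := Quotient.mk'' ⟨x, hl.left_mem⟩ with hq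
  have hx : x ∈ nodeSet q := (mem_nodeSet hl.left_mem).2 rfl
  have hclosed : ∀ e ∈ F, ∀ u v, G.IsLink e u v → (u ∈ nodeSet q ↔ v ∈ nodeSet q) := by
    intro e he u v huv
    have huv' : G.IsLink e (⟨u, huv.left_mem⟩ : V(G)) (⟨v, huv.right_mem⟩ : V(G)) := huv
    rw [mem_nodeSet huv.left_mem, mem_nodeSet huv.right_mem,
      Quotient.sound' (joinedBy_of_isLink (Finset.mem_coe.2 he) huv')]
  have hy : y ∈ nodeSet q := (hclosed e he x y hl).1 hx
  refine hS (nodeSet q) (nodeSet_subset q) ?_ hx hy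
  -- A cut of the component with fewer than `π` edges could be removed from `F` at a profit.
  intro C hC
  obtain ⟨A, hA, ⟨a, ha⟩, hAV, rfl⟩ := mem_cuts.1 hC
  have hA : A ⊆ nodeSet q := hA
  have hAV : A ≠ nodeSet q := hAV
  obtain ⟨b, hb, hbA⟩ := Set.exists_of_ssubset (hA.ssubset_of_ne hAV)
  set D := cutEdges (G.induce (nodeSet q)) A with hD
  have h1 := hF.2 (F \ D) (Finset.sdiff_subset.trans hF.1)
  have haV := nodeSet_subset q (hA ha)
  have hbV := nodeSet_subset q hb
  have hlt : numNodesAfterContracting G (F : Set β)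
      < numNodesAfterContracting G ((F \ D : Finset β) : Set β) := by
    refine card_quotient_lt_of_le (x := ⟨a, haV⟩) (y := ⟨b, hbV⟩)
      (joinedBy_mono (by exact_mod_cast Finset.sdiff_subset)) ?_ ?_
    · exact Quotient.exact' (((mem_nodeSet haV).1 (hA ha)).trans ((mem_nodeSet hbV).1 hb).symm)
    · intro hj
      refine hbA ((iff_of_joinedBy (P := (· ∈ A)) ?_ hj).1 ha)
      intro e he u v huv
      have he := Finset.mem_sdiff.1 (Finset.mem_coe.1 he)
      have hc := hclosed e he.1 u v huv
      by_cases hu : u ∈ nodeSet q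
      · have hl2 : (G.induce (nodeSet q)).IsLink e u v := ⟨huv, hu, hc.1 hu⟩
        have := (mem_cutEdges_iff_of_isLink (A := A) hl2).not.1 he.2
        tauto
      · have hv : v ∉ nodeSet q := fun hv => hu (hc.2 hv)
        exact ⟨fun h => absurd (hA h) hu, fun h => absurd (hA h) hv⟩
  have h2 : F.card ≤ (F \ D).card + D.card := Finset.card_le_card_sdiff_add_card
  have h2' : (F.card : ℝ) ≤ (F \ D).card + D.card := by exact_mod_cast h2
  have h3 : (numNodesAfterContracting G (F : Set β) : ℝ) + 1
      ≤ numNodesAfterContracting G ((F \ D : Finset β) : Set β) := by exact_mod_cast hlt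
  have hk0 : (0 : ℝ) ≤ k := Nat.cast_nonneg k
  have h4 : (k : ℝ) ≤ D.card := by nlinarith
  exact_mod_cast h4

end

section

open Classical

variable {α β : Type*} [Finite α] [Fintype β]

/-! ### Loads of the latter half of the packing -/

omit [Fintype β] in
theorem IsSpanningTree.ne_of_isLink {G : Graph α β} {T : Finset β} (hV : V(G).Nonempty)
    (hT : IsSpanningTree G T) {e : β} (he : e ∈ T) {x y : α} (hl : G.IsLink e x y) : x ≠ y := by
  rintro rfl
  have h1 := hT.numNodes_add_card hV (Finset.erase_subset e T)
  have h2 := hT.numNodes_add_card hV subset_rfl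
  have hl' : G.IsLink e (⟨x, hl.left_mem⟩ : V(G)) (⟨x, hl.left_mem⟩ : V(G)) := hl
  have h3 := numNodes_insert_of_joinedBy hl'
    ((joinedBy G ((T.erase e : Finset β) : Set β)).refl ⟨x, hl.left_mem⟩)
  rw [← Finset.coe_insert, Finset.insert_erase he] at h3
  have := Finset.card_erase_add_one he
  omega

/-- The standing assumptions on the packing: the strong components of `G` are contracted, and
`2 * R` rounds are enough for loads of relative accuracy `γ`. The bound `rounds` is what the
potential argument needs for all parameters `π ≤ 6 λ`. -/
structure IsAccuratePacking (G : Graph α β) (R : ℕ) (T : ℕ → Finset β) (γ : ℝ) : Prop where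
  two_le : 2 ≤ V(G).ncard
  connects : Connects G E(G)
  strong : StrongComponentsTrivial G (3 * minCut G)
  greedy : IsGreedyTreePacking G (2 * R) T
  rounds_pos : 0 < R
  pos : 0 < γ
  le : γ ≤ 1 / 100
  rounds : 36 * (6 * minCut G) * Real.log E(G).ncard ≤ R * γ ^ 2

namespace IsAccuratePacking

variable {G : Graph α β} {R : ℕ} {T : ℕ → Finset β} {γ : ℝ}

omit [Finite α] in
theorem nonempty (h : IsAccuratePacking G R T γ) : V(G).Nonempty :=
  Set.nonempty_of_ncard_ne_zero (by have := h.two_le; omega)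

omit [Finite α] in
theorem minCut_pos (h : IsAccuratePacking G R T γ) : (0 : ℝ) < minCut G := by
  exact_mod_cast _root_.minCut_pos h.two_le h.connects

omit [Finite α] in
theorem rounds_le (h : IsAccuratePacking G R T γ) {π : ℝ} (hπ : π ≤ 6 * minCut G) {t : ℕ}
    (ht : R ≤ t) : 36 * π * Real.log E(G).ncard ≤ t * γ ^ 2 := by
  have h1 : 0 ≤ Real.log E(G).ncard := Real.log_natCast_nonneg _
  have h2 : (R : ℝ) ≤ t := by exact_mod_cast ht
  calc 36 * π * Real.log E(G).ncard ≤ 36 * (6 * minCut G) * Real.log E(G).ncard := by gcongr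
    _ ≤ R * γ ^ 2 := h.rounds
    _ ≤ t * γ ^ 2 := by gcongr

theorem useCount_le (h : IsAccuratePacking G R T γ) {π : ℝ} (hπ : 0 < π)
    (hπ6 : π ≤ 6 * minCut G) {F : Finset β} (hF : IsPrincipal G π F) {t : ℕ} (ht : R ≤ t)
    (ht2 : t ≤ 2 * R) {e : β} (he : e ∈ F) : (useCount T t e : ℝ) ≤ (1 + γ) * t / π :=
  h.greedy.useCount_le h.nonempty hπ hF h.pos (by linarith [h.le]) ht2 (h.rounds_le hπ6 ht) he

theorem le_useCount (h : IsAccuratePacking G R T γ) {π : ℝ} (hπ : 0 < π)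
    (hπ6 : π ≤ 6 * minCut G) {F : Finset β} (hF : IsPrincipal G π F) {t : ℕ} (ht : R ≤ t)
    (ht2 : t ≤ 2 * R) {e : β} (heG : e ∈ E(G)) (he : e ∉ F) :
    (1 - γ) * t / π ≤ (useCount T t e : ℝ) :=
  h.greedy.le_useCount h.nonempty hπ hF h.pos (by linarith [h.le]) ht2 (h.rounds_le hπ6 ht)
    heG he

/-- Every edge `e` has a scale `π` between `λ / 2` and `3 λ` such that the load of `e` stays
close to `1 / π` during the latter half of the packing. -/
theorem exists_scale (h : IsAccuratePacking G R T γ) {e : β} {x y : α} (hl : G.IsLink e x y)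
    (hxy : x ≠ y) : ∃ π : ℝ, (minCut G : ℝ) / 2 ≤ π ∧ π ≤ 3 * minCut G ∧
      ∀ t, R ≤ t → t ≤ 2 * R → (1 - γ) * t / (π * (1 + γ)) ≤ useCount T t e ∧
        (useCount T t e : ℝ) ≤ (1 + γ) * t / π := by
  have hlam := h.minCut_pos
  have hγ := h.pos
  choose F hF using exists_isPrincipal G
  let s : ℕ → ℝ := fun g => minCut G / 2 * (1 + γ) ^ g
  have hs : ∀ g, 0 < s g := fun g => by positivity
  have hloop : ∀ π, 3 * (minCut G : ℝ) ≤ π → e ∉ F π := fun π hπ he =>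
    hxy ((hF π).eq_of_isLink (k := 3 * minCut G) (by push_cast; exact hπ) h.strong he hl)
  -- The scale is the last one, on a geometric grid, at which `e` lies in the principal set.
  have hex : ∃ g, e ∉ F (s g) := by
    obtain ⟨g, hg⟩ := pow_unbounded_of_one_lt 6 (show 1 < 1 + γ by linarith)
    exact ⟨g, hloop _ (by simp only [s]; nlinarith)⟩
  have hmin := fun g => Nat.find_min hex (m := g)
  have hspec := Nat.find_spec hex
  rcases hg0 : Nat.find hex with _ | g
  · exfalso
    rw [hg0] at hspec
    apply hspec
    rw [(hF (s 0)).eq_allEdges h.nonempty h.connects (hs 0)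
      (by simp only [s, pow_zero]; linarith)]
    exact mem_allEdges.2 hl.edge_mem
  · rw [hg0] at hspec
    have hin : e ∈ F (s g) := by
      by_contra hno
      exact hmin g (by omega) hno
    have hle3 : s g ≤ 3 * minCut G := by
      by_contra hlt
      exact hloop _ (not_le.1 hlt).le hin
    have hsucc : s (g + 1) = s g * (1 + γ) := by simp only [s]; ring
    have hge : (minCut G : ℝ) / 2 ≤ s g :=
      le_mul_of_one_le_right (by positivity) (one_le_pow₀ (by linarith))
    have hle6 : s (g + 1) ≤ 6 * minCut G := by
      rw [hsucc]
      nlinarith [h.le]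
    refine ⟨s g, hge, hle3, fun t ht ht2 => ⟨?_, ?_⟩⟩
    · rw [← hsucc]
      exact h.le_useCount (hs _) hle6 (hF _) ht ht2 hl.edge_mem hspec
    · exact h.useCount_le (hs g) (by linarith) (hF _) ht ht2 hin

/-- The load of an edge over the latter half agrees with its load after `R` rounds up to a
relative error `O(γ)`, and lies between about `1 / (3 λ)` and `2 / λ`. -/
theorem load_bounds (h : IsAccuratePacking G R T γ) {e : β} {x y : α} (hl : G.IsLink e x y)
    (hxy : x ≠ y) : ∃ π : ℝ, 0 < π ∧ (minCut G : ℝ) / 2 ≤ π ∧ π ≤ 3 * minCut G ∧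
      (1 - 2 * γ) * R / π ≤ useCount T R e ∧ (useCount T R e : ℝ) ≤ (1 + γ) * R / π ∧
      (1 - 5 * γ) / π ≤ load (latterHalf T R) e ∧
      load (latterHalf T R) e ≤ (1 + 4 * γ) / π := by
  have hlam := h.minCut_pos
  have hγ := h.pos
  have hγ1 := h.le
  have hR : (0 : ℝ) < R := by exact_mod_cast h.rounds_pos
  obtain ⟨π, hπ1, hπ2, hπ⟩ := h.exists_scale hl hxy
  have hπ0 : 0 < π := by linarith
  obtain ⟨h1, h2⟩ := hπ R le_rfl (by omega)
  obtain ⟨h3, h4⟩ := hπ (2 * R) (by omega) le_rfl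
  have hfac : (1 - γ) ^ 2 ≤ (1 - γ) / (1 + γ) := by
    rw [le_div_iff₀ (by linarith)]
    nlinarith [sq_nonneg γ, mul_nonneg hγ.le (sq_nonneg γ)]
  have h1' : (1 - γ) ^ 2 * (R / π) ≤ useCount T R e := by
    calc _ ≤ (1 - γ) / (1 + γ) * (R / π) := by gcongr
      _ = (1 - γ) * R / (π * (1 + γ)) := by field_simp
      _ ≤ _ := h1
  have h3' : 2 * (1 - γ) ^ 2 * (R / π) ≤ useCount T (2 * R) e := by
    calc _ ≤ 2 * ((1 - γ) / (1 + γ)) * (R / π) := by gcongr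
      _ = (1 - γ) * (2 * R : ℕ) / (π * (1 + γ)) := by push_cast; field_simp
      _ ≤ _ := h3
  have h2' : (useCount T R e : ℝ) ≤ (1 + γ) * (R / π) := by rw [← mul_div_assoc]; exact h2
  have h4' : (useCount T (2 * R) e : ℝ) ≤ 2 * (1 + γ) * (R / π) := by
    calc _ ≤ _ := h4
      _ = _ := by push_cast; ring
  have hRπ : 0 < R / π := by positivity
  refine ⟨π, hπ0, hπ1, hπ2, ?_, h2, ?_, ?_⟩
  · refine le_trans ?_ h1'
    rw [mul_div_assoc]
    gcongr
    nlinarith [sq_nonneg γ]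
  · rw [load_latterHalf, le_div_iff₀ hR]
    calc (1 - 5 * γ) / π * R = (1 - 5 * γ) * (R / π) := by ring
      _ ≤ (2 * (1 - γ) ^ 2 - (1 + γ)) * (R / π) :=
          mul_le_mul_of_nonneg_right (by nlinarith [sq_nonneg γ]) hRπ.le
      _ ≤ _ := by linarith
  · rw [load_latterHalf, div_le_iff₀ hR]
    calc _ ≤ (2 * (1 + γ) - (1 - γ) ^ 2) * (R / π) := by linarith
      _ ≤ (1 + 4 * γ) * (R / π) :=
          mul_le_mul_of_nonneg_right (by nlinarith [sq_nonneg γ]) hRπ.le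
      _ = _ := by ring

theorem load_le (h : IsAccuratePacking G R T γ) {e : β} {x y : α} (hl : G.IsLink e x y)
    (hxy : x ≠ y) : load (latterHalf T R) e ≤ 2 * (1 + 4 * γ) / minCut G := by
  have hlam := h.minCut_pos
  have hγ := h.pos
  obtain ⟨π, hπ0, hπ1, -, -, -, -, h2⟩ := h.load_bounds hl hxy
  refine h2.trans ?_
  rw [div_le_div_iff₀ hπ0 hlam]
  nlinarith

theorem le_load (h : IsAccuratePacking G R T γ) {e : β} {x y : α} (hl : G.IsLink e x y)
    (hxy : x ≠ y) : (1 - 5 * γ) / (3 * minCut G) ≤ load (latterHalf T R) e := by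
  have hγ1 := h.le
  obtain ⟨π, hπ0, -, hπ2, -, -, h1, -⟩ := h.load_bounds hl hxy
  refine le_trans ?_ h1
  gcongr
  linarith

theorem load_le_of_mem (h : IsAccuratePacking G R T γ) {e : β} {x y : α}
    (hl : G.IsLink e x y) (hxy : x ≠ y) {π : ℝ} (hπ : 0 < π) (hπ6 : π ≤ 6 * minCut G)
    {F : Finset β} (hF : IsPrincipal G π F) (he : e ∈ F) :
    load (latterHalf T R) e ≤ (1 + 10 * γ) / π := by
  have hγ := h.pos
  have hγ1 := h.le
  have hR : (0 : ℝ) < R := by exact_mod_cast h.rounds_pos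
  obtain ⟨π', hπ0, -, -, h1, -, -, h2⟩ := h.load_bounds hl hxy
  have h3 := h1.trans (h.useCount_le hπ hπ6 hF le_rfl (by omega) he)
  rw [div_le_div_iff₀ hπ0 hπ] at h3
  have h4 : (1 - 2 * γ) * π ≤ (1 + γ) * π' := by
    refine le_of_mul_le_mul_right ?_ hR
    linarith
  refine h2.trans ?_
  rw [div_le_div_iff₀ hπ0 hπ]
  have h5 : (1 + 4 * γ) * (1 + γ) ≤ (1 + 10 * γ) * (1 - 2 * γ) := by nlinarith
  refine le_of_mul_le_mul_left ?_ (show 0 < 1 - 2 * γ by linarith)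
  calc (1 - 2 * γ) * ((1 + 4 * γ) * π) = (1 + 4 * γ) * ((1 - 2 * γ) * π) := by ring
    _ ≤ (1 + 4 * γ) * ((1 + γ) * π') := by gcongr
    _ = (1 + 4 * γ) * (1 + γ) * π' := by ring
    _ ≤ (1 + 10 * γ) * (1 - 2 * γ) * π' := by gcongr
    _ = _ := by ring

theorem le_load_of_notMem (h : IsAccuratePacking G R T γ) {e : β} {x y : α}
    (hl : G.IsLink e x y) (hxy : x ≠ y) {π : ℝ} (hπ : 0 < π) (hπ6 : π ≤ 6 * minCut G)
    {F : Finset β} (hF : IsPrincipal G π F) (he : e ∉ F) :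
    (1 - 10 * γ) / π ≤ load (latterHalf T R) e := by
  have hγ := h.pos
  have hγ1 := h.le
  have hR : (0 : ℝ) < R := by exact_mod_cast h.rounds_pos
  obtain ⟨π', hπ0, -, -, -, h1, h2, -⟩ := h.load_bounds hl hxy
  have h3 := (h.le_useCount hπ hπ6 hF le_rfl (by omega) hl.edge_mem he).trans h1
  rw [div_le_div_iff₀ hπ hπ0] at h3
  have h4 : (1 - γ) * π' ≤ (1 + γ) * π := by
    refine le_of_mul_le_mul_right ?_ hR
    linarith
  refine le_trans ?_ h2
  rw [div_le_div_iff₀ hπ hπ0]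
  have h5 : (1 - 10 * γ) * (1 + γ) ≤ (1 - 5 * γ) * (1 - γ) := by nlinarith
  refine le_of_mul_le_mul_left ?_ (show 0 < 1 - γ by linarith)
  calc (1 - γ) * ((1 - 10 * γ) * π') = (1 - 10 * γ) * ((1 - γ) * π') := by ring
    _ ≤ (1 - 10 * γ) * ((1 + γ) * π) := by gcongr; linarith
    _ = (1 - 10 * γ) * (1 + γ) * π := by ring
    _ ≤ (1 - 5 * γ) * (1 - γ) * π := by gcongr
    _ = _ := by ring

/-- A tree of the latter half has fewer edges of load at least `1 / π` than there are nodes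
after contracting a principal set of a slightly larger parameter `π''`. -/
theorem card_filter_load_ge_lt (h : IsAccuratePacking G R T γ) {π : ℝ} (hπ : 0 < π)
    {F : Finset β} (hF : IsPrincipal G (π * (1 + 12 * γ) * (1 + 4 * γ)) F)
    (hπ6 : π * (1 + 12 * γ) * (1 + 4 * γ) ≤ 6 * minCut G) (r : Fin R) :
    ((latterHalf T R r).filter fun e => 1 / π ≤ load (latterHalf T R) e).card + 1
      ≤ numNodesAfterContracting G (F : Set β) := by
  have hγ := h.pos
  have hγ1 := h.le
  set j : ℕ := R + r with hj
  have hj2 : j < 2 * R := by have := r.2; omega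
  have hjpos : (0 : ℝ) < j := by
    have := h.rounds_pos
    exact_mod_cast (show 0 < R + r by omega)
  have hM := h.greedy.isMinSpanningTree_useCount hj2
  have hT : latterHalf T R r = T j := rfl
  rw [hT]
  obtain ⟨F', hF'⟩ := exists_isPrincipal G (π * (1 + 12 * γ))
  have hπ' : 0 < π * (1 + 12 * γ) := by positivity
  have hπ6' : π * (1 + 12 * γ) ≤ 6 * minCut G := by nlinarith
  set x : ℝ := (1 - γ) * j / (π * (1 + 12 * γ)) with hx
  have hsub : (T j).filter (fun e => 1 / π ≤ load (latterHalf T R) e)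
      ⊆ (T j).filter fun e => x ≤ (useCount T j e : ℝ) := by
    intro e he
    obtain ⟨heT, he⟩ := Finset.mem_filter.1 he
    refine Finset.mem_filter.2 ⟨heT, ?_⟩
    obtain ⟨u, v, hl⟩ := exists_isLink_of_mem_edgeSet (hM.1.1 e heT)
    have huv := hM.1.ne_of_isLink h.nonempty heT hl
    refine h.le_useCount hπ' hπ6' hF' (by omega) hj2.le hl.edge_mem fun heF => ?_
    have h1 := he.trans (h.load_le_of_mem hl huv hπ' hπ6' hF' heF)
    rw [div_le_div_iff₀ hπ hπ'] at h1
    nlinarith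
  have h1 := hM.card_ge_add_one h.nonempty x
  have h2 : numNodesAfterContracting G {e | (useCount T j e : ℝ) < x}
      ≤ numNodesAfterContracting G (F : Set β) := by
    refine numNodes_anti fun e he => ?_
    have h3 := h.useCount_le (by positivity) hπ6 hF (by omega) hj2.le (Finset.mem_coe.1 he)
    refine lt_of_le_of_lt h3 ?_
    rw [hx, div_lt_div_iff₀ (by positivity) (by positivity)]
    have h5 : (1 + γ) < (1 - γ) * (1 + 4 * γ) := by nlinarith
    calc (1 + γ) * j * (π * (1 + 12 * γ)) = (1 + γ) * (j * (π * (1 + 12 * γ))) := by ring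
      _ < (1 - γ) * (1 + 4 * γ) * (j * (π * (1 + 12 * γ))) := by gcongr
      _ = _ := by ring
  have := Finset.card_le_card hsub
  omega

theorem numNodes_le_of_load_lt (h : IsAccuratePacking G R T γ) {π π' : ℝ} (hπ : 0 < π)
    (hπ6 : π ≤ 6 * minCut G) {F : Finset β} (hF : IsPrincipal G π F)
    (hπ' : 1 / π' ≤ (1 - 10 * γ) / π) :
    numNodesAfterContracting G (F : Set β)
      ≤ numNodesAfterContracting G {e | load (latterHalf T R) e < 1 / π'} := by
  refine numNodes_le_of_le (joinedBy_le fun e he u v hl => ?_)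
  by_cases huv : u = v
  · rw [huv]
  refine joinedBy_of_isLink (Finset.mem_coe.2 ?_) hl
  by_contra heF
  have := h.le_load_of_notMem hl (fun h => huv (Subtype.ext h)) hπ hπ6 hF heF
  have he : load (latterHalf T R) e < 1 / π' := he
  linarith

end IsAccuratePacking

/-! ### Levels -/

theorem levelPi_succ (lam : ℕ) (δ : ℝ) (i : ℕ) :
    levelPi lam δ (i + 1) = levelPi lam δ i * (1 + δ) := by
  simp only [levelPi]; ring

theorem levelPi_pos {lam : ℕ} (hlam : (0 : ℝ) < lam) {δ : ℝ} (hδ : 0 ≤ δ) (i : ℕ) :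
    0 < levelPi lam δ i := by
  unfold levelPi; positivity

theorem levelPi_mono (lam : ℕ) {δ : ℝ} (hδ : 0 ≤ δ) : Monotone (levelPi lam δ) := by
  intro i j hij
  unfold levelPi
  gcongr
  linarith

omit [Finite α] in
theorem mem_level {G : Graph α β} {δ : ℝ} {ℓ : β → ℝ} {i : ℕ} {e : β} :
    e ∈ level G δ ℓ i ↔ e ∈ E(G) ∧ 1 / levelPi (minCut G) δ i ≤ ℓ e ∧
      ℓ e < (1 + δ) / levelPi (minCut G) δ i := by
  simp [level]

omit [Finite α] in
theorem level_unique {G : Graph α β} (hlam : (0 : ℝ) < minCut G) {δ : ℝ} (hδ : 0 ≤ δ)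
    {ℓ : β → ℝ} {i j : ℕ} {e : β} (hi : e ∈ level G δ ℓ i) (hj : e ∈ level G δ ℓ j) :
    i = j := by
  have key : ∀ i j, i < j → e ∈ level G δ ℓ i → e ∈ level G δ ℓ j → False := by
    intro i j hij hi hj
    have h1 := (mem_level.1 hi).2.1
    have h2 := (mem_level.1 hj).2.2
    have h3 := levelPi_mono (minCut G) hδ hij
    have h4 := levelPi_pos hlam hδ i
    have h5 := levelPi_pos hlam hδ j
    rw [Nat.succ_eq_add_one, levelPi_succ] at h3
    have h6 := h1.trans_lt h2
    rw [div_lt_div_iff₀ h4 h5] at h6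
    linarith
  rcases lt_trichotomy i j with h | h | h
  · exact (key i j h hi hj).elim
  · exact h
  · exact (key j i h hj hi).elim

/-- All levels in use, and the next one, have `π_i ≤ 6 λ`, the range of accurate loads. -/
theorem levelPi_le {lam : ℕ} {δ : ℝ} (hδ : 0 < δ) (hδ1 : δ ≤ 1 / 10) {i : ℕ}
    (hi : i ≤ numLevels δ) : levelPi lam δ i ≤ 6 * lam := by
  have h1 : 0 < Real.log (1 + δ) := Real.log_pos (by linarith)
  have h2 : (i : ℝ) ≤ Real.log 6 / Real.log (1 + δ) + 3 := by
    have h3 : (⌈Real.log 6 / Real.log (1 + δ)⌉₊ : ℝ) < Real.log 6 / Real.log (1 + δ) + 1 :=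
      Nat.ceil_lt_add_one (div_nonneg (Real.log_nonneg (by norm_num)) h1.le)
    have h4 : (i : ℝ) ≤ ((numLevels δ : ℕ) : ℝ) := by exact_mod_cast hi
    rw [numLevels] at h4
    push_cast at h4
    linarith
  have h5 : (1 + δ) ^ i ≤ 6 * (1 + δ) ^ 3 := by
    rw [← Real.log_le_log_iff (by positivity) (by positivity),
      Real.log_mul (by norm_num) (by positivity), Real.log_pow, Real.log_pow]
    calc (i : ℝ) * Real.log (1 + δ)
        ≤ (Real.log 6 / Real.log (1 + δ) + 3) * Real.log (1 + δ) := by gcongr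
      _ = _ := by push_cast; field_simp
  have h6 : (1 + δ) ^ 3 ≤ 2 := by
    calc (1 + δ) ^ 3 ≤ (1 + 1 / 10) ^ 3 := by gcongr
      _ ≤ 2 := by norm_num
  have hlam : (0 : ℝ) ≤ lam := Nat.cast_nonneg _
  unfold levelPi
  nlinarith

namespace IsAccuratePacking

variable {G : Graph α β} {R : ℕ} {T : ℕ → Finset β} {δ : ℝ}

/-- Every edge that is not a loop lies in one of the levels. -/
theorem exists_mem_level (h : IsAccuratePacking G R T (δ / 100)) (hδ1 : δ ≤ 1 / 10) {e : β}
    {x y : α} (hl : G.IsLink e x y) (hxy : x ≠ y) :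
    ∃ i < numLevels δ, e ∈ level G δ (load (latterHalf T R)) i := by
  have hlam := h.minCut_pos
  have hδ : 0 < δ := by linarith [h.pos]
  have hpos := fun i => levelPi_pos hlam hδ.le i
  have h1 : 0 < Real.log (1 + δ) := Real.log_pos (by linarith)
  -- The last level starts at `1 / (3 λ (1 + δ))` or below, which is less than every load.
  have hlast : 1 / levelPi (minCut G) δ (numLevels δ - 1) ≤ load (latterHalf T R) e := by
    refine le_trans ?_ (h.le_load hl hxy)
    set L := ⌈Real.log 6 / Real.log (1 + δ)⌉₊ with hL
    have h2 : Real.log 6 / Real.log (1 + δ) ≤ L := Nat.le_ceil _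
    have h3 : (6 : ℝ) ≤ (1 + δ) ^ L := by
      rw [← Real.log_le_log_iff (by norm_num) (by positivity), Real.log_pow]
      rwa [div_le_iff₀ h1] at h2
    have h4 : numLevels δ - 1 = L + 1 := by rw [numLevels]; omega
    have h5 : 3 * minCut G * (1 + δ) ≤ levelPi (minCut G) δ (L + 1) := by
      rw [levelPi_succ]
      gcongr
      unfold levelPi
      nlinarith
    rw [h4, div_le_div_iff₀ (hpos _) (by positivity), one_mul]
    have h6 : 1 ≤ (1 - 5 * (δ / 100)) * (1 + δ) := by nlinarith
    calc 3 * (minCut G : ℝ) ≤ (1 - 5 * (δ / 100)) * (1 + δ) * (3 * minCut G) :=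
          le_mul_of_one_le_left (by positivity) h6
      _ = (1 - 5 * (δ / 100)) * (3 * minCut G * (1 + δ)) := by ring
      _ ≤ _ := mul_le_mul_of_nonneg_left h5 (by linarith)
  have hex : ∃ i, 1 / levelPi (minCut G) δ i ≤ load (latterHalf T R) e := ⟨_, hlast⟩
  refine ⟨Nat.find hex, ?_, mem_level.2 ⟨hl.edge_mem, Nat.find_spec hex, ?_⟩⟩
  · have := Nat.find_min' hex hlast
    have : 2 ≤ numLevels δ := by rw [numLevels]; omega
    omega
  · rcases hi : Nat.find hex with _ | i
    · refine lt_of_le_of_lt (h.load_le hl hxy) ?_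
      rw [levelPi, pow_zero, one_mul, div_div_eq_mul_div]
      exact div_lt_div_of_pos_right (by linarith) hlam
    · have := not_le.1 (Nat.find_min hex (m := i) (by omega))
      rw [levelPi_succ, mul_comm, div_mul_eq_div_div, div_self (by linarith : 1 + δ ≠ 0)] 
      exact this

/-- For every level `i` there is a dense set `F` whose contraction keeps few edges, has at most
`k̃_{π_{i+1}}` nodes, and has more nodes than any tree of the latter half has edges in level `i`.
It is a principal set for a parameter strictly between `π_i` and `π_{i+1}`, where the gap absorbs
the inaccuracy of the loads. -/
theorem exists_contraction (h : IsAccuratePacking G R T (δ / 100)) (hδ1 : δ ≤ 1 / 10) {i : ℕ}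
    (hi : i < numLevels δ) : ∃ F ⊆ allEdges G,
      ((allEdges G \ F).card : ℝ)
        ≤ levelPi (minCut G) δ (i + 1) * (numNodesAfterContracting G (F : Set β) - 1) ∧
      numNodesAfterContracting G (F : Set β) ≤ kTilde G δ (load (latterHalf T R)) (i + 1) ∧
      ∀ r, (latterHalf T R r ∩ level G δ (load (latterHalf T R)) i).card + 1
        ≤ numNodesAfterContracting G (F : Set β) := by
  have hlam := h.minCut_pos
  have hδ : 0 < δ := by linarith [h.pos]
  have hpos := levelPi_pos hlam hδ.le i
  set γ := δ / 100 with hγ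
  have hγ0 := h.pos
  have hδγ : δ = 100 * γ := by rw [hγ]; ring
  have hγ1 : γ ≤ 1 / 1000 := by rw [hγ]; linarith
  set π := levelPi (minCut G) δ i with hπ
  have h1 : π * (1 + 12 * γ) * (1 + 4 * γ) ≤ levelPi (minCut G) δ (i + 1) * (1 - 10 * γ) := by
    rw [levelPi_succ, mul_assoc, mul_assoc]
    exact mul_le_mul_of_nonneg_left (by rw [hδγ]; nlinarith) hpos.le
  have hpos1 := levelPi_pos hlam hδ.le (i + 1)
  have h2 : π * (1 + 12 * γ) * (1 + 4 * γ) ≤ levelPi (minCut G) δ (i + 1) := by nlinarith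
  have h6 : π * (1 + 12 * γ) * (1 + 4 * γ) ≤ 6 * minCut G := h2.trans (levelPi_le hδ hδ1 hi)
  obtain ⟨F, hF⟩ := exists_isPrincipal G (π * (1 + 12 * γ) * (1 + 4 * γ))
  have hπ0 : 0 < π * (1 + 12 * γ) * (1 + 4 * γ) := by positivity
  refine ⟨F, hF.1, ?_, ?_, fun r => ?_⟩
  · refine (hF.card_sdiff_le h.nonempty h.connects).trans ?_
    have : (1 : ℝ) ≤ numNodesAfterContracting G (F : Set β) := by
      exact_mod_cast numNodes_pos h.nonempty _
    gcongr
  · refine h.numNodes_le_of_load_lt hπ0 h6 hF ?_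
    rw [div_le_div_iff₀ hpos1 hπ0]
    linarith
  · refine le_trans ?_ (h.card_filter_load_ge_lt hpos hF h6 r)
    gcongr
    intro e he
    have he := Finset.mem_inter.1 he
    exact Finset.mem_filter.2 ⟨he.1, (mem_level.1 he.2).2.1⟩

end IsAccuratePacking

end

section

open Classical

variable {α β : Type*} [Fintype β]

/-! ### Cuts and spanning trees -/

/-- A cut is determined, up to exchanging its sides, by the edges of a connecting set that it
crosses. -/
theorem eq_or_eq_sdiff_of_cutEdges {G : Graph α β} {F : Set β} (hF : Connects G F)
    {A B : Set α} (hA : A ⊆ V(G)) (hB : B ⊆ V(G))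
    (h : ∀ e ∈ F, e ∈ cutEdges G A ↔ e ∈ cutEdges G B) : A = B ∨ A = V(G) \ B := by
  have key : ∀ e ∈ F, ∀ x y, G.IsLink e x y → ((x ∈ A ↔ x ∈ B) ↔ (y ∈ A ↔ y ∈ B)) := by
    intro e he x y hl
    have := h e he
    rw [mem_cutEdges_iff_of_isLink hl, mem_cutEdges_iff_of_isLink hl] at this
    tauto
  by_cases hne : ∃ x : V(G), ((x : α) ∈ A ↔ (x : α) ∈ B)
  · obtain ⟨x, hx⟩ := hne
    left
    ext y
    by_cases hy : y ∈ V(G)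
    · exact (iff_of_joinedBy (P := fun x => (x ∈ A ↔ x ∈ B)) key (hF x ⟨y, hy⟩)).1 hx
    · exact ⟨fun h => absurd (hA h) hy, fun h => absurd (hB h) hy⟩
  · push Not at hne
    right
    ext y
    by_cases hy : y ∈ V(G)
    · have := hne ⟨y, hy⟩
      simp only [Set.mem_sdiff, hy, true_and]
      tauto
    · exact ⟨fun h => absurd (hA h) hy, fun h => absurd h.1 hy⟩

theorem cutEdges_compl (G : Graph α β) (A : Set α) : cutEdges G (V(G) \ A) = cutEdges G A := by
  ext e
  by_cases he : e ∈ E(G)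
  · obtain ⟨x, y, hl⟩ := exists_isLink_of_mem_edgeSet he
    rw [mem_cutEdges_iff_of_isLink hl, mem_cutEdges_iff_of_isLink hl]
    simp only [Set.mem_sdiff, hl.left_mem, hl.right_mem, true_and]
    tauto
  · constructor <;> intro h <;> obtain ⟨x, -, y, -, hl⟩ := mem_cutEdges.1 h <;>
      exact absurd hl.edge_mem he

theorem cutEdges_eq_of_inter_eq {G : Graph α β} {T : Finset β} (hT : Connects G (T : Set β))
    {A B : Set α} (hA : A ⊆ V(G)) (hB : B ⊆ V(G))
    (h : cutEdges G A ∩ T = cutEdges G B ∩ T) : cutEdges G A = cutEdges G B := by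
  rcases eq_or_eq_sdiff_of_cutEdges hT hA hB fun e he => by
    have := Finset.ext_iff.1 h e
    simp only [Finset.mem_inter, Finset.mem_coe.1 he, and_true] at this
    exact this with rfl | rfl
  · rfl
  · exact cutEdges_compl G B

theorem cutOfTreeEdges_inter {G : Graph α β} {T C : Finset β} (hT : Connects G (T : Set β))
    (hC : C ∈ cuts G) : cutOfTreeEdges G T (T ∩ C) = C := by
  obtain ⟨A, hA, -, -, rfl⟩ := mem_cuts.1 hC
  have hex : ∃ B : Set α, B ⊆ V(G) ∧ cutEdges G B ∩ T = T ∩ cutEdges G A :=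
    ⟨A, hA, Finset.inter_comm _ _⟩
  rw [cutOfTreeEdges, dif_pos hex]
  have hs := hex.choose_spec
  exact cutEdges_eq_of_inter_eq hT hs.1 hA (hs.2.trans (Finset.inter_comm _ _))

theorem inter_injOn_cuts {G : Graph α β} {T : Finset β} (hT : Connects G (T : Set β)) :
    Set.InjOn (fun C => T ∩ C) (cuts G : Set (Finset β)) := by
  intro C hC D hD h
  rw [← cutOfTreeEdges_inter hT hC, ← cutOfTreeEdges_inter hT hD]
  exact congrArg _ h

theorem inter_nonempty_of_mem_cuts {G : Graph α β} {T C : Finset β}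
    (hT : Connects G (T : Set β)) (hC : C ∈ cuts G) : (T ∩ C).Nonempty := by
  obtain ⟨A, hA, hne, hAV, rfl⟩ := mem_cuts.1 hC
  obtain ⟨e, heT, he⟩ := exists_mem_cutEdges hT hA hne hAV
  exact ⟨e, Finset.mem_inter.2 ⟨heT, he⟩⟩

theorem exists_isLink_of_mem_cut {G : Graph α β} {C : Finset β} (hC : C ∈ cuts G) {e : β}
    (he : e ∈ C) : ∃ x y, G.IsLink e x y ∧ x ≠ y := by
  obtain ⟨A, -, -, -, rfl⟩ := mem_cuts.1 hC
  obtain ⟨x, hx, y, hy, hl⟩ := mem_cutEdges.1 he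
  exact ⟨x, y, hl, fun h => hy (h ▸ hx)⟩

/-! ### Lower bounds on the total weight of the relevant cuts -/

theorem mem_relevantCuts {G : Graph α β} {n : ℕ} {ℓ : β → ℝ} {C : Finset β} :
    C ∈ relevantCuts G n ℓ ↔ C ∈ cuts G ∧ cutLoad ℓ C ≤ 2 * Real.log n := by
  simp [relevantCuts]

omit [Fintype β] in
theorem cutLoad_le_of_forall {ℓ : β → ℝ} {C : Finset β} {b : ℝ} (h : ∀ e ∈ C, ℓ e ≤ b) :
    cutLoad ℓ C ≤ C.card * b := by
  rw [cutLoad, ← nsmul_eq_mul]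
  exact Finset.sum_le_card_nsmul _ _ _ h

theorem pow_minCut_le_zPrime {G : Graph α β} {n : ℕ} {ℓ : β → ℝ} {p : ℝ}
    (h2 : 2 ≤ V(G).ncard) (hlam : (0 : ℝ) < minCut G) (hp : 0 < p)
    (hℓ : ∀ C ∈ cuts G, ∀ e ∈ C, ℓ e ≤ 4 / minCut G) (hn : 48 ≤ Real.log n) :
    p ^ minCut G ≤ zPrime G n ℓ p := by
  obtain ⟨C, hC, hcard⟩ := exists_card_eq_minCut h2
  rw [← hcard]
  refine Finset.single_le_sum (f := fun C : Finset β => p ^ C.card)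
    (fun C _ => (pow_pos hp _).le) (mem_relevantCuts.2 ⟨hC, ?_⟩)
  have := cutLoad_le_of_forall (hℓ C hC)
  rw [hcard, mul_div_cancel₀ _ hlam.ne'] at this
  linarith

/-- If contracting `F` leaves `k` nodes and at most `π (k - 1)` edges, then by Markov's
inequality a `δ / 4` fraction of the `k` degree cuts have at most `2 π (1 + δ)` edges. The load
of such a cut is at most `96`, so it is relevant as soon as `log n ≥ 48`. -/
theorem mul_rpow_le_zPrime [Finite α] {G : Graph α β} {n : ℕ} {ℓ : β → ℝ} {p π δ : ℝ}
    (hG : Connects G E(G)) (hlam : (0 : ℝ) < minCut G) (hp : 0 < p) (hp1 : p < 1)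
    (hℓ : ∀ C ∈ cuts G, ∀ e ∈ C, ℓ e ≤ 4 / minCut G) (hn : 48 ≤ Real.log n)
    (hδ : 0 < δ) (hδ1 : δ ≤ 1 / 10) (hπ : 0 < π) (hπ6 : π ≤ 6 * minCut G) {F : Finset β}
    (hF : ((allEdges G \ F).card : ℝ) ≤ π * (numNodesAfterContracting G (F : Set β) - 1))
    (hk : 2 ≤ numNodesAfterContracting G (F : Set β)) :
    δ / 4 * numNodesAfterContracting G (F : Set β) * p ^ (2 * π * (1 + δ))
      ≤ zPrime G n ℓ p := by
  let _ : Fintype (Quotient (joinedBy G (F : Set β))) := Fintype.ofFinite _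
  set k := numNodesAfterContracting G (F : Set β) with hkdef
  have hcard : k = Fintype.card (Quotient (joinedBy G (F : Set β))) := Nat.card_eq_fintype_card
  have : Nontrivial (Quotient (joinedBy G (F : Set β))) :=
    Fintype.one_lt_card_iff_nontrivial.1 (by omega)
  -- One node is left out, so that different nodes define different cuts.
  obtain ⟨q₀⟩ : Nonempty (Quotient (joinedBy G (F : Set β))) := inferInstance
  set d : Quotient (joinedBy G (F : Set β)) → ℕ := fun q => (cutEdges G (nodeSet q)).card with hd
  have hcuts : ∀ q : Quotient (joinedBy G (F : Set β)), cutEdges G (nodeSet q) ∈ cuts G := by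
    intro q
    obtain ⟨q', hq'⟩ := exists_ne q
    exact cutEdges_nodeSet_mem_cuts hq'.symm
  set D := 2 * π * (1 + δ) with hD
  have hDpos : 0 < D := by positivity
  set S := (Finset.univ.erase q₀).filter fun q => (d q : ℝ) ≤ D with hS
  have hsplit : S.card + ((Finset.univ.erase q₀).filter fun q => ¬ (d q : ℝ) ≤ D).card = k - 1 := by
    rw [hS, Finset.card_filter_add_card_filter_not, Finset.card_erase_of_mem (Finset.mem_univ _),
      Finset.card_univ, hcard]
  set B := (Finset.univ.erase q₀).filter fun q => ¬ (d q : ℝ) ≤ D with hB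
  have hsum : ∑ q, (d q : ℝ) ≤ 2 * π * (k - 1) := by
    have h1 := sum_card_cutEdges_nodeSet_le (G := G) F
    have h2 : ∑ q, (d q : ℝ) ≤ 2 * (allEdges G \ F).card := by exact_mod_cast h1
    linarith
  have hmarkov : (B.card : ℝ) * D ≤ 2 * π * (k - 1) := by
    refine le_trans ?_ hsum
    calc (B.card : ℝ) * D = ∑ q ∈ B, D := by rw [Finset.sum_const, nsmul_eq_mul]
      _ ≤ ∑ q ∈ B, (d q : ℝ) :=
          Finset.sum_le_sum fun q hq => (not_le.1 (Finset.mem_filter.1 hq).2).le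
      _ ≤ ∑ q, (d q : ℝ) := Finset.sum_le_univ_sum_of_nonneg fun q => Nat.cast_nonneg _
  have hsplit' : (S.card : ℝ) + B.card = k - 1 := by
    rw [← Nat.cast_one, ← Nat.cast_sub (by omega)]
    exact_mod_cast hsplit
  have hk' : (2 : ℝ) ≤ k := by exact_mod_cast hk
  have hB' : (B.card : ℝ) * (1 + δ) ≤ k - 1 := by
    refine le_of_mul_le_mul_left ?_ (show 0 < 2 * π by positivity)
    rw [hD] at hmarkov
    linarith
  have hScard : δ / 4 * k ≤ S.card := by
    have h1 : (k - 1) * δ ≤ S.card * (1 + δ) := by nlinarith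
    have h2 : (k : ℝ) / 2 * δ ≤ (k - 1) * δ := by gcongr; linarith
    have h3 : (S.card : ℝ) * (1 + δ) ≤ S.card * 2 := by gcongr; linarith
    linarith
  have hinj : Set.InjOn (fun q : Quotient (joinedBy G (F : Set β)) => cutEdges G (nodeSet q))
      (S : Set (Quotient (joinedBy G (F : Set β)))) := by
    intro q hq q' hq' heq
    have heq : cutEdges G (nodeSet q) = cutEdges G (nodeSet q') := heq
    have hdisj : ∀ r r' : Quotient (joinedBy G (F : Set β)), ∀ a, a ∈ nodeSet r →
        a ∈ nodeSet r' → r = r' := fun r r' a h h' =>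
      ((mem_nodeSet h.1).1 h).symm.trans ((mem_nodeSet h.1).1 h')
    rcases eq_or_eq_sdiff_of_cutEdges hG (nodeSet_subset q) (nodeSet_subset q')
      (fun e _ => by rw [heq]) with h | h
    · obtain ⟨a, ha⟩ := nodeSet_nonempty q
      exact hdisj q q' a ha (h ▸ ha)
    · exfalso
      have hq := Finset.ne_of_mem_erase (Finset.mem_filter.1 (Finset.mem_coe.1 hq)).1
      have hq' := Finset.ne_of_mem_erase (Finset.mem_filter.1 (Finset.mem_coe.1 hq')).1
      obtain ⟨a, ha⟩ := nodeSet_nonempty q₀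
      by_cases ha' : a ∈ nodeSet q'
      · exact hq' (hdisj _ _ a ha' ha)
      · exact hq (hdisj _ _ a (h ▸ ⟨nodeSet_subset _ ha, ha'⟩) ha)
  have hrel : ∀ q ∈ S, cutEdges G (nodeSet q) ∈ relevantCuts G n ℓ := by
    intro q hq
    refine mem_relevantCuts.2 ⟨hcuts q, ?_⟩
    refine (cutLoad_le_of_forall (hℓ _ (hcuts q))).trans ?_
    have h1 : ((cutEdges G (nodeSet q)).card : ℝ) ≤ D := (Finset.mem_filter.1 hq).2
    calc ((cutEdges G (nodeSet q)).card : ℝ) * (4 / minCut G) ≤ D * (4 / minCut G) := by gcongr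
      _ ≤ (2 * (6 * minCut G) * 2) * (4 / minCut G) := by
          rw [hD]; gcongr; linarith
      _ = 96 := by field_simp; norm_num
      _ ≤ _ := by linarith
  calc δ / 4 * k * p ^ D ≤ S.card * p ^ D := by gcongr
    _ = ∑ q ∈ S, p ^ D := by rw [Finset.sum_const, nsmul_eq_mul]
    _ ≤ ∑ q ∈ S, p ^ (cutEdges G (nodeSet q)).card := by
        refine Finset.sum_le_sum fun q hq => ?_
        rw [← Real.rpow_natCast]
        exact Real.rpow_le_rpow_of_exponent_ge hp hp1.le (Finset.mem_filter.1 hq).2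
    _ = ∑ C ∈ S.image fun q => cutEdges G (nodeSet q), p ^ C.card :=
        (Finset.sum_image (f := fun C : Finset β => p ^ C.card) hinj).symm
    _ ≤ zPrime G n ℓ p := by
        refine Finset.sum_le_sum_of_subset_of_nonneg ?_ fun C _ _ => (pow_pos hp _).le
        intro C hC
        obtain ⟨q, hq, rfl⟩ := Finset.mem_image.1 hC
        exact hrel q hq

/-! ### The probability of sampling a cut -/

/-- If the levels cover `T ∩ C` disjointly, the sampler on the tree `T` finds `C` by choosing
the right vector `j` and the right edges. -/
theorem le_treeCutSampler {G : Graph α β} {n : ℕ} {δ : ℝ} {ℓ : β → ℝ} {T C : Finset β}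
    (hT : Connects G (T : Set β)) (hC : C ∈ cuts G)
    (hcover : ∀ e ∈ T ∩ C, ∃ i : Fin (numLevels δ), e ∈ level G δ ℓ i)
    (hdisj : ∀ i j : Fin (numLevels δ), ∀ e, e ∈ level G δ ℓ i → e ∈ level G δ ℓ j → i = j)
    (hsmall : ((T ∩ C).card : ℝ) ≤ 8 * Real.log n) :
    ((admissible G n δ ℓ T).card : ENNReal)⁻¹ *
      ((∏ i : Fin (numLevels δ), (T ∩ level G δ ℓ i).card.choose
        ((T ∩ C) ∩ level G δ ℓ i).card : ℕ) : ENNReal)⁻¹ ≤ treeCutSampler G n δ ℓ T C := by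
  set j : Fin (numLevels δ) → ℕ := fun i => ((T ∩ C) ∩ level G δ ℓ i).card with hj
  set F : Fin (numLevels δ) → Finset β := fun i => (T ∩ C) ∩ level G δ ℓ i with hF
  have hFun : Finset.univ.biUnion F = T ∩ C := by
    ext e
    simp only [hF, Finset.mem_biUnion, Finset.mem_univ, true_and]
    constructor
    · rintro ⟨i, hi⟩
      exact (Finset.mem_inter.1 hi).1
    · intro he
      obtain ⟨i, hi⟩ := hcover e he
      exact ⟨i, Finset.mem_inter.2 ⟨he, hi⟩⟩
  have hjsum : ∑ i, j i = (T ∩ C).card := by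
    rw [← hFun, Finset.card_biUnion]
    intro i _ i' _ hii
    rw [Function.onFun, Finset.disjoint_left]
    intro e he he'
    exact hii (hdisj i i' e (Finset.mem_inter.1 he).2 (Finset.mem_inter.1 he').2)
  have hsub : ∀ i, F i ⊆ T ∩ level G δ ℓ i := fun i =>
    Finset.inter_subset_inter_right Finset.inter_subset_left
  have hjadm : j ∈ admissible G n δ ℓ T := by
    simp only [admissible, Finset.mem_filter, Fintype.mem_piFinset, Finset.mem_range]
    refine ⟨fun i => Nat.lt_succ_of_le (Finset.card_le_card ?_), ?_⟩
    · convert hsub i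
    · rw [hjsum]; exact hsmall
  have hFmem : F ∈ edgeChoices G δ ℓ T j := by
    simp only [edgeChoices, Fintype.mem_piFinset, Finset.mem_powersetCard]
    intro i
    exact ⟨by convert hsub i, rfl⟩
  have hcardE : (edgeChoices G δ ℓ T j).card
      = ∏ i : Fin (numLevels δ), (T ∩ level G δ ℓ i).card.choose (j i) := by
    rw [edgeChoices, Fintype.card_piFinset]
    refine Finset.prod_congr rfl fun i _ => ?_
    rw [Finset.card_powersetCard]
  have : Nonempty {j // j ∈ admissible G n δ ℓ T} := ⟨⟨j, hjadm⟩⟩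
  rw [treeCutSampler, PMF.bind_apply]
  refine le_trans ?_ (ENNReal.le_tsum ⟨j, hjadm⟩)
  rw [PMF.uniformOfFintype_apply, Fintype.card_coe]
  gcongr
  rw [PMF.map_apply]
  refine le_trans ?_ (ENNReal.le_tsum F)
  rw [if_pos (by rw [hFun, cutOfTreeEdges_inter hT hC]), PMF.uniformOfFinset_apply_of_mem _ hFmem,
    hcardE]

theorem le_cutSampler {G : Graph α β} {n : ℕ} {δ : ℝ} {ℓ : β → ℝ} {N : ℕ} [NeZero N]
    (𝒯' : Fin N → Finset β) (k : Fin N) (C : Finset β) :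
    (N : ENNReal)⁻¹ * treeCutSampler G n δ ℓ (𝒯' k) C ≤ cutSampler G n δ ℓ 𝒯' C := by
  rw [cutSampler, PMF.bind_apply]
  refine le_trans ?_ (ENNReal.le_tsum k)
  rw [PMF.uniformOfFintype_apply, Fintype.card_fin]

theorem card_admissible_le {G : Graph α β} {n : ℕ} {δ : ℝ} {ℓ : β → ℝ} {T : Finset β} :
    ((admissible G n δ ℓ T).card : ℝ) ≤ (8 * Real.log n + 1) ^ numLevels δ := by
  have h8 : 0 ≤ 8 * Real.log n := by
    have := Real.log_natCast_nonneg n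
    linarith
  have hsub : admissible G n δ ℓ T
      ⊆ Fintype.piFinset fun _ => Finset.range (⌊8 * Real.log n⌋₊ + 1) := by
    intro j hj
    have hj := (Finset.mem_filter.1 hj).2
    rw [Fintype.mem_piFinset]
    intro i
    rw [Finset.mem_range, Nat.lt_succ_iff]
    refine Nat.le_floor (le_trans ?_ hj)
    exact_mod_cast Finset.single_le_sum (fun i _ => Nat.zero_le (j i)) (Finset.mem_univ i)
  have h1 := Finset.card_le_card hsub
  rw [Fintype.card_piFinset, Finset.prod_const, Finset.card_univ, Fintype.card_fin,
    Finset.card_range] at h1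
  calc ((admissible G n δ ℓ T).card : ℝ)
      ≤ ((⌊8 * Real.log n⌋₊ + 1 : ℕ) : ℝ) ^ numLevels δ := by exact_mod_cast h1
    _ ≤ _ := by
        gcongr
        push_cast
        have := Nat.floor_le h8
        linarith

end

section

open Classical

variable {α β : Type*}

/-! ### Averages over the trees of the packing -/

theorem sum_sum_inter_eq {R : ℕ} (hR : 0 < R) (𝒯 : Fin R → Finset β) (C : Finset β)
    (v : β → ℝ) : ∑ r, ∑ e ∈ 𝒯 r ∩ C, v e = R * ∑ e ∈ C, load 𝒯 e * v e := by
  have hR' : (R : ℝ) ≠ 0 := by exact_mod_cast hR.ne'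
  have h1 : ∀ r, ∑ e ∈ 𝒯 r ∩ C, v e = ∑ e ∈ C, if e ∈ 𝒯 r then v e else 0 := by
    intro r
    rw [← Finset.sum_filter, Finset.filter_mem_eq_inter, Finset.inter_comm]
  simp only [h1]
  rw [Finset.sum_comm, Finset.mul_sum]
  refine Finset.sum_congr rfl fun e _ => ?_
  rw [← Finset.sum_filter, Finset.sum_const, nsmul_eq_mul, load, ← mul_assoc,
    mul_div_cancel₀ _ hR']

/-- Markov's inequality on `Fin R`, in the form that a `δ / 2` fraction of the values stays below
`1 + δ` times the mean. -/
theorem le_card_filter_lt {R : ℕ} {f : Fin R → ℝ} (hf : ∀ r, 0 ≤ f r) {μ δ : ℝ} (hμ : 0 < μ)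
    (hδ : 0 < δ) (hδ1 : δ ≤ 1) (hsum : ∑ r, f r ≤ R * μ) :
    δ / 2 * R ≤ (Finset.univ.filter fun r => f r < (1 + δ) * μ).card := by
  have h1 := Finset.card_filter_add_card_filter_not (s := (Finset.univ : Finset (Fin R)))
    (fun r => f r < (1 + δ) * μ)
  rw [Finset.card_univ, Fintype.card_fin] at h1
  set A := Finset.univ.filter fun r => f r < (1 + δ) * μ
  set B := Finset.univ.filter fun r => ¬ f r < (1 + δ) * μ with hB
  have h1' : (A.card : ℝ) + B.card = R := by exact_mod_cast h1
  have h2 : (B.card : ℝ) * ((1 + δ) * μ) ≤ R * μ := by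
    refine le_trans ?_ hsum
    calc (B.card : ℝ) * ((1 + δ) * μ) = ∑ r ∈ B, (1 + δ) * μ := by
          rw [Finset.sum_const, nsmul_eq_mul]
      _ ≤ ∑ r ∈ B, f r := Finset.sum_le_sum fun r hr => not_lt.1 (Finset.mem_filter.1 hr).2
      _ ≤ ∑ r, f r := Finset.sum_le_univ_sum_of_nonneg hf
  have h3 : (B.card : ℝ) * (1 + δ) ≤ R := by
    refine le_of_mul_le_mul_right ?_ hμ
    linarith
  have hA : (0 : ℝ) ≤ A.card := Nat.cast_nonneg _
  nlinarith

theorem le_card_filter_eq_one {R : ℕ} {f : Fin R → ℕ} (hf : ∀ r, 1 ≤ f r) {δ : ℝ}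
    (hsum : ∑ r, (f r : ℝ) ≤ R * (2 - δ)) :
    δ * R ≤ (Finset.univ.filter fun r => f r = 1).card := by
  have h1 : (2 * R : ℝ) ≤ ∑ r, (f r : ℝ) + (Finset.univ.filter fun r => f r = 1).card := by
    have h2 : ∑ r : Fin R, 2 ≤ ∑ r, (f r + if f r = 1 then 1 else 0) := by
      refine Finset.sum_le_sum fun r _ => ?_
      have := hf r
      split_ifs <;> omega
    rw [Finset.sum_add_distrib, ← Finset.card_filter, Finset.sum_const, Finset.card_univ,
      Fintype.card_fin, smul_eq_mul, mul_comm] at h2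
    exact_mod_cast h2
  linarith

/-! ### Trees that cross a cut in a favourable way -/

/-- The exponent estimate. Here `v` and `b` are the logarithmic costs of an edge, and `y` is the
slack in the assumption on the level of the edge. The slack of the single level that bounds
`z'` is recovered from the cut, because the total load of the cut is at least nearly `2`. -/
theorem exponent_estimate {C : Finset β} {ℓ v y b : β → ℝ} {δ P Λ y₀ : ℝ} (hδ : 0 < δ)
    (hδ1 : δ ≤ 1 / 10) (hΛ : 0 ≤ Λ) (hP : 0 ≤ P) (hy₀ : 0 ≤ y₀) (hy₁ : y₀ ≤ 12000 * Λ)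
    (hℓ : ∀ e ∈ C, 0 ≤ ℓ e) (hb : ∀ e ∈ C, ℓ e * b e ≤ (1 + δ) ^ 2 * P)
    (hbv : ∀ e ∈ C, b e = v e + y e / 2 + 15 * δ * Λ) (hv : ∀ e ∈ C, v e ≤ Λ)
    (hy : ∀ e ∈ C, y₀ ≤ y e) (hsum : 2 - δ ≤ ∑ e ∈ C, ℓ e) :
    (1 + δ) * ∑ e ∈ C, ℓ e * v e - C.card * P + y₀ ≤ 30000 * δ * Λ := by
  have key : ∀ e ∈ C, (1 + δ) * (ℓ e * v e) - P ≤ ℓ e * (-(1 - 2 * δ) * (y₀ / 2)) := by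
    intro e he
    have h1 : (1 - 2 * δ) * (ℓ e * b e) ≤ P := by
      calc (1 - 2 * δ) * (ℓ e * b e) ≤ (1 - 2 * δ) * ((1 + δ) ^ 2 * P) :=
            mul_le_mul_of_nonneg_left (hb e he) (by linarith)
        _ = ((1 - 2 * δ) * (1 + δ) ^ 2) * P := by ring
        _ ≤ 1 * P := by
            refine mul_le_mul_of_nonneg_right ?_ hP
            nlinarith [sq_nonneg δ, mul_nonneg hδ.le (sq_nonneg δ)]
        _ = P := one_mul P
    have h2 : (1 + δ) * v e - (1 - 2 * δ) * b e ≤ -(1 - 2 * δ) * (y₀ / 2) := by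
      rw [hbv e he]
      have h3 : δ * v e ≤ δ * Λ := mul_le_mul_of_nonneg_left (hv e he) hδ.le
      have h4 : (1 - 2 * δ) * (y₀ / 2) ≤ (1 - 2 * δ) * (y e / 2) :=
        mul_le_mul_of_nonneg_left (by linarith [hy e he]) (by linarith)
      have h5 : 3 * (δ * Λ) ≤ (1 - 2 * δ) * (15 * (δ * Λ)) := by
        nlinarith [mul_nonneg hδ.le hΛ]
      linarith
    have h6 := mul_le_mul_of_nonneg_left h2 (hℓ e he)
    linarith
  have h1 := Finset.sum_le_sum key
  rw [Finset.sum_sub_distrib, ← Finset.mul_sum, ← Finset.sum_mul, Finset.sum_const,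
    nsmul_eq_mul] at h1
  have h2 : (2 - δ) * ((1 - 2 * δ) * (y₀ / 2)) ≤ (∑ e ∈ C, ℓ e) * ((1 - 2 * δ) * (y₀ / 2)) :=
    mul_le_mul_of_nonneg_right hsum (mul_nonneg (by linarith) (by linarith))
  have h3 : y₀ - (2 - δ) * ((1 - 2 * δ) * (y₀ / 2)) ≤ 5 / 2 * (δ * y₀) := by
    nlinarith [mul_nonneg (sq_nonneg δ) hy₀]
  have h4 : δ * y₀ ≤ δ * (12000 * Λ) := mul_le_mul_of_nonneg_left hy₁ hδ.le
  linarith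

variable [Finite α] [Fintype β]

omit [Finite α] in
/-- The number of ways to choose the tree edges level by level is at most the product of the
node counts of the levels of the chosen edges. -/
theorem prod_choose_le {G : Graph α β} {δ : ℝ} {ℓ : β → ℝ} {T C : Finset β}
    {K : ℕ → ℕ} {idx : β → ℕ} (hidx : ∀ e ∈ C, idx e < numLevels δ ∧ e ∈ level G δ ℓ (idx e))
    (huniq : ∀ i j, ∀ e, e ∈ level G δ ℓ i → e ∈ level G δ ℓ j → i = j)
    (hK : ∀ i < numLevels δ, (T ∩ level G δ ℓ i).card ≤ K i) :
    ∏ i : Fin (numLevels δ), (T ∩ level G δ ℓ i).card.choose ((T ∩ C) ∩ level G δ ℓ i).card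
      ≤ ∏ e ∈ T ∩ C, K (idx e) := by
  have hun : T ∩ C = Finset.univ.biUnion
      fun i : Fin (numLevels δ) => (T ∩ C) ∩ level G δ ℓ i := by
    ext e
    simp only [Finset.mem_biUnion, Finset.mem_univ, true_and]
    constructor
    · intro he
      obtain ⟨h1, h2⟩ := hidx e (Finset.mem_inter.1 he).2
      exact ⟨⟨_, h1⟩, Finset.mem_inter.2 ⟨he, h2⟩⟩
    · rintro ⟨i, hi⟩
      exact (Finset.mem_inter.1 hi).1
  conv_rhs => rw [hun]
  rw [Finset.prod_biUnion]
  · refine Finset.prod_le_prod' fun i _ => ?_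
    rw [Finset.prod_congr rfl (g := fun _ => K i) fun e he => by
      have he := Finset.mem_inter.1 he
      rw [huniq _ _ e (hidx e (Finset.mem_inter.1 he.1).2).2 he.2], Finset.prod_const]
    exact (Nat.choose_le_pow _ _).trans (Nat.pow_le_pow_left (hK i i.2) _)
  · intro i _ i' _ hii
    rw [Function.onFun, Finset.disjoint_left]
    intro e he he'
    exact hii (Fin.ext (huniq i i' e (Finset.mem_inter.1 he).2 (Finset.mem_inter.1 he').2))

/-- For every relevant cut `C`, a `δ / 2` fraction of the trees crosses `C` in few edges, and in
such a way that the number of edge choices of the sampler is small. -/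
theorem exists_good_trees {G : Graph α β} {R : ℕ} {T : ℕ → Finset β} {δ p : ℝ} {n : ℕ}
    (h : IsAccuratePacking G R T (δ / 100)) (hδ1 : δ ≤ 1 / 10) (hn : 48 ≤ Real.log n)
    (hVn : V(G).ncard ≤ n) (hp : 0 < p) (hp1 : p < 1)
    (hassum : ∀ i : ℕ, (n : ℝ) ^ (1 + 30 * δ) * kTilde G δ (load (latterHalf T R)) i
        * p ^ (2 * levelPi (minCut G) δ i) ≤ 1)
    (hp1000 : (n : ℝ) ^ (-1000 : ℝ) ≤ p ^ minCut G)
    {C : Finset β} (hC : C ∈ relevantCuts G n (load (latterHalf T R))) :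
    ∃ S : Finset (Fin R), δ / 2 * R ≤ S.card ∧ ∀ r ∈ S,
      ((latterHalf T R r ∩ C).card : ℝ) ≤ 8 * Real.log n ∧
      ((∏ i : Fin (numLevels δ),
        (latterHalf T R r ∩ level G δ (load (latterHalf T R)) i).card.choose
          ((latterHalf T R r ∩ C) ∩ level G δ (load (latterHalf T R)) i).card : ℕ) : ℝ)
        * p ^ C.card ≤ 4 / δ * (n : ℝ) ^ (1 + 50000 * δ)
          * zPrime G n (load (latterHalf T R)) p := by
  have hδ : 0 < δ := by linarith [h.pos]
  have hlam := h.minCut_pos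
  have hR := h.rounds_pos
  have hR' : (0 : ℝ) < R := by exact_mod_cast hR
  set ℓ := load (latterHalf T R) with hℓdef
  obtain ⟨hCcut, hCload⟩ := mem_relevantCuts.1 hC
  have hn0 : (0 : ℝ) < n := by
    rcases Nat.eq_zero_or_pos n with rfl | hpos
    · simp at hn; linarith
    · exact_mod_cast hpos
  set Λ := Real.log n with hΛ
  have htree : ∀ r : Fin R, IsSpanningTree G (latterHalf T R r) := fun r =>
    (h.greedy (R + r) (by have := r.2; omega)).1
  have hℓ4 : ∀ C ∈ cuts G, ∀ e ∈ C, ℓ e ≤ 4 / minCut G := by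
    intro C hC e he
    obtain ⟨x, y, hl, hxy⟩ := exists_isLink_of_mem_cut hC he
    refine (h.load_le hl hxy).trans ?_
    gcongr
    linarith
  have hlev : ∀ e : β, ∃ i, e ∈ C → i < numLevels δ ∧ e ∈ level G δ ℓ i := by
    intro e
    by_cases he : e ∈ C
    · obtain ⟨x, y, hl, hxy⟩ := exists_isLink_of_mem_cut hCcut he
      obtain ⟨i, hi⟩ := h.exists_mem_level hδ1 hl hxy
      exact ⟨i, fun _ => hi⟩
    · exact ⟨0, fun h => absurd h he⟩
  choose idx hidx using hlev
  have hFs : ∀ i, ∃ F : Finset β, i < numLevels δ → ((allEdges G \ F).card : ℝ)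
        ≤ levelPi (minCut G) δ (i + 1) * (numNodesAfterContracting G (F : Set β) - 1) ∧
      numNodesAfterContracting G (F : Set β) ≤ kTilde G δ ℓ (i + 1) ∧
      ∀ r, (latterHalf T R r ∩ level G δ ℓ i).card + 1
        ≤ numNodesAfterContracting G (F : Set β) := by
    intro i
    by_cases hi : i < numLevels δ
    · obtain ⟨F, -, hF⟩ := h.exists_contraction hδ1 hi
      exact ⟨F, fun _ => hF⟩
    · exact ⟨∅, fun h => absurd h hi⟩
  choose F hF using hFs
  set K : ℕ → ℕ := fun i => numNodesAfterContracting G (F i : Set β) with hK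
  have hK1 : ∀ i, 1 ≤ K i := fun i => numNodes_pos h.nonempty _
  have hKn : ∀ i, (K i : ℝ) ≤ n := fun i => by
    exact_mod_cast (numNodes_le_ncard G _).trans hVn
  have hprod : ∀ r, ((∏ i : Fin (numLevels δ), (latterHalf T R r ∩ level G δ ℓ i).card.choose
      ((latterHalf T R r ∩ C) ∩ level G δ ℓ i).card : ℕ) : ℝ)
      ≤ ∏ e ∈ latterHalf T R r ∩ C, (K (idx e) : ℝ) := by
    intro r
    exact_mod_cast prod_choose_le hidx (fun i j e => level_unique hlam hδ.le)
      (fun i hi => (Nat.le_succ _).trans ((hF i hi).2.2 r))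
  have hcross : ∀ r, 1 ≤ (latterHalf T R r ∩ C).card := fun r =>
    Finset.card_pos.2 (inter_nonempty_of_mem_cuts (htree r).2.1 hCcut)
  have hz0 := pow_minCut_le_zPrime (n := n) h.two_le hlam hp hℓ4 hn
  have hzpos : 0 < zPrime G n ℓ p := (pow_pos hp _).trans_le hz0
  by_cases hJ : ∑ e ∈ C, ℓ e < 2 - δ
  · -- If the load of the cut is less than `2 - δ`, many trees cross it in a single edge.
    refine ⟨Finset.univ.filter fun r => (latterHalf T R r ∩ C).card = 1, ?_, fun r hr => ?_⟩
    · refine le_trans ?_ (le_card_filter_eq_one hcross (δ := δ) ?_)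
      · nlinarith
      · have := sum_sum_inter_eq hR (latterHalf T R) C fun _ => (1 : ℝ)
        simp only [Finset.sum_const, nsmul_eq_mul, mul_one] at this
        rw [this]
        exact mul_le_mul_of_nonneg_left hJ.le hR'.le
    · have hr := (Finset.mem_filter.1 hr).2
      obtain ⟨e, he⟩ := Finset.card_eq_one.1 hr
      refine ⟨by rw [hr]; push_cast; linarith, ?_⟩
      have h1 := hprod r
      rw [he, Finset.prod_singleton] at h1
      have h2 : p ^ C.card ≤ zPrime G n ℓ p :=
        (pow_le_pow_of_le_one hp.le hp1.le (minCut_le_card hCcut)).trans hz0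
      have h3 : (n : ℝ) ≤ 4 / δ * (n : ℝ) ^ (1 + 50000 * δ) := by
        have hn1 : (1 : ℝ) ≤ n := by
          by_contra hlt
          have := Real.log_nonpos hn0.le (not_le.1 hlt).le
          linarith
        calc (n : ℝ) = 1 * (n : ℝ) ^ (1 : ℝ) := by rw [Real.rpow_one, one_mul]
          _ ≤ 4 / δ * (n : ℝ) ^ (1 + 50000 * δ) := by
            gcongr
            · rw [le_div_iff₀ hδ]; linarith
            · linarith
      rw [he]
      calc _ ≤ (n : ℝ) * zPrime G n ℓ p :=
            mul_le_mul (h1.trans (hKn _)) h2 (pow_pos hp _).le hn0.le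
        _ ≤ _ := mul_le_mul_of_nonneg_right h3 hzpos.le
  · -- Otherwise a tree is good if its total cost `∑ v e` is close to the mean `μ`. The slack `y`
    -- is smallest at `e₀`, whose level provides the lower bound for `z'`.
    push Not at hJ
    set P := -Real.log p with hP
    have hP0 : 0 < P := neg_pos.2 (Real.log_neg hp hp1)
    have hlamP : minCut G * P ≤ 1000 * Λ := by
      have := Real.log_le_log (by positivity) hp1000
      rw [Real.log_rpow hn0, Real.log_pow] at this
      rw [hP]
      linarith
    set π : β → ℝ := fun e => levelPi (minCut G) δ (idx e + 1) with hπ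
    have hπ0 : ∀ e, 0 < π e := fun e => levelPi_pos hlam hδ.le _
    have hπ6 : ∀ e ∈ C, π e ≤ 6 * minCut G := fun e he => levelPi_le hδ hδ1 (hidx e he).1
    set κ : β → ℝ := fun e => Real.log (K (idx e)) with hκ
    have hκ0 : ∀ e, 0 ≤ κ e := fun e => Real.log_natCast_nonneg _
    have hκΛ : ∀ e, κ e ≤ Λ := fun e =>
      Real.log_le_log (by exact_mod_cast hK1 _) (hKn _)
    set v : β → ℝ := fun e => (Λ + κ e) / 2 with hv
    set b : β → ℝ := fun e => π e * P with hb
    set y : β → ℝ := fun e => 2 * b e - κ e - (1 + 30 * δ) * Λ with hy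
    have hℓ0 : ∀ e ∈ C, 0 < ℓ e := by
      intro e he
      exact (by have := levelPi_pos hlam hδ.le (idx e); positivity :
        0 < 1 / levelPi (minCut G) δ (idx e)).trans_le (mem_level.1 (hidx e he).2).2.1
    have hK2 : ∀ e ∈ C, 2 ≤ K (idx e) := by
      intro e he
      have h1 : ∃ r, e ∈ latterHalf T R r := by
        by_contra! hno
        have h0 := hℓ0 e he
        rw [hℓdef, load, Finset.filter_false_of_mem fun r _ => hno r] at h0
        simp at h0
      obtain ⟨r, hr⟩ := h1
      have h2 := (hF _ (hidx e he).1).2.2 r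
      have h3 : 0 < (latterHalf T R r ∩ level G δ ℓ (idx e)).card :=
        Finset.card_pos.2 ⟨e, Finset.mem_inter.2 ⟨hr, (hidx e he).2⟩⟩
      simp only [hK]
      omega
    have hy0 : ∀ e ∈ C, 0 ≤ y e := by
      intro e he
      have h1 := hassum (idx e + 1)
      have h2 : (K (idx e) : ℝ) ≤ kTilde G δ ℓ (idx e + 1) := by
        exact_mod_cast (hF _ (hidx e he).1).2.1
      have hKpos : (0 : ℝ) < K (idx e) := by exact_mod_cast hK1 _
      have h3 : (n : ℝ) ^ (1 + 30 * δ) * K (idx e) * p ^ (2 * π e) ≤ 1 := by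
        refine le_trans ?_ h1
        gcongr
      have h4 := Real.log_le_log (by positivity) h3
      rw [Real.log_mul (by positivity) (by positivity), Real.log_mul (by positivity) hKpos.ne',
        Real.log_rpow hn0, Real.log_rpow hp, Real.log_one] at h4
      simp only [hy, hb, hP, hκ]
      linarith
    obtain ⟨e₀, he₀, hmin⟩ := Finset.exists_min_image C y (by
      by_contra hemp
      rw [Finset.not_nonempty_iff_eq_empty.1 hemp, Finset.sum_empty] at hJ
      linarith)
    have hb0 : ∀ e ∈ C, b e ≤ 6000 * Λ := by
      intro e he
      calc b e ≤ 6 * minCut G * P := mul_le_mul_of_nonneg_right (hπ6 e he) hP0.le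
        _ ≤ 6000 * Λ := by linarith
    have hexp := exponent_estimate (C := C) (ℓ := ℓ) (v := v) (y := y) (b := b) (P := P)
      (Λ := Λ) (y₀ := y e₀) hδ hδ1 (by linarith) hP0.le (hy0 e₀ he₀) (by
        have := hb0 e₀ he₀
        have := hκ0 e₀
        have : 0 ≤ (1 + 30 * δ) * Λ := mul_nonneg (by linarith) (by linarith)
        simp only [hy]
        linarith) (fun e he => (hℓ0 e he).le) (by
        intro e he
        have h1 := (mem_level.1 (hidx e he).2).2.2
        have h2 := levelPi_pos hlam hδ.le (idx e)
        rw [lt_div_iff₀ h2] at h1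
        simp only [hb, hπ, levelPi_succ]
        calc ℓ e * (levelPi (minCut G) δ (idx e) * (1 + δ) * P)
            = ℓ e * levelPi (minCut G) δ (idx e) * ((1 + δ) * P) := by ring
          _ ≤ (1 + δ) * ((1 + δ) * P) := by gcongr
          _ = _ := by ring) (fun e _ => by simp only [hy, hv]; ring)
      (fun e _ => by have := hκΛ e; simp only [hv]; linarith) hmin hJ
    set μ := ∑ e ∈ C, ℓ e * v e with hμ
    have hv0 : ∀ e, Λ / 2 ≤ v e := fun e => by have := hκ0 e; simp only [hv]; linarith
    have hμ0 : 0 < μ := by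
      refine Finset.sum_pos (fun e he => mul_pos (hℓ0 e he) ?_) ⟨e₀, he₀⟩
      linarith [hv0 e]
    have hμle : μ ≤ 2 * Λ * Λ := by
      calc μ ≤ ∑ e ∈ C, ℓ e * Λ := by
            refine Finset.sum_le_sum fun e he => mul_le_mul_of_nonneg_left ?_ (hℓ0 e he).le
            have := hκΛ e
            simp only [hv]
            linarith
        _ = cutLoad ℓ C * Λ := by rw [← Finset.sum_mul, cutLoad]
        _ ≤ _ := mul_le_mul_of_nonneg_right hCload (by linarith)
    refine ⟨Finset.univ.filter fun r => ∑ e ∈ latterHalf T R r ∩ C, v e < (1 + δ) * μ, ?_,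
      fun r hr => ?_⟩
    · exact le_card_filter_lt (fun r => Finset.sum_nonneg fun e _ => by linarith [hv0 e]) hμ0 hδ
        (by linarith) (sum_sum_inter_eq hR (latterHalf T R) C v).le
    have hr := (Finset.mem_filter.1 hr).2
    refine ⟨?_, ?_⟩
    · have h1 : ((latterHalf T R r ∩ C).card : ℝ) * (Λ / 2)
          ≤ ∑ e ∈ latterHalf T R r ∩ C, v e := by
        rw [← nsmul_eq_mul]
        exact Finset.card_nsmul_le_sum _ _ _ fun e _ => hv0 e
      have h2 : (1 + δ) * μ ≤ 2 * (2 * Λ * Λ) := by nlinarith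
      refine le_of_mul_le_mul_right ?_ (show 0 < Λ / 2 by linarith)
      linarith
    · have hKpos : ∀ e, (0 : ℝ) < K (idx e) := fun e => by exact_mod_cast hK1 _
      have h1 : ∏ e ∈ latterHalf T R r ∩ C, (K (idx e) : ℝ) ≤ Real.exp ((1 + δ) * μ) := by
        calc ∏ e ∈ latterHalf T R r ∩ C, (K (idx e) : ℝ)
            = Real.exp (∑ e ∈ latterHalf T R r ∩ C, κ e) := by
              rw [Real.exp_sum]
              exact Finset.prod_congr rfl fun e _ => (Real.exp_log (hKpos e)).symm
          _ ≤ Real.exp ((1 + δ) * μ) := by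
              refine Real.exp_le_exp.2 (le_trans (Finset.sum_le_sum fun e _ => ?_) hr.le)
              have := hκΛ e
              simp only [hv]
              linarith
      have h2 := mul_rpow_le_zPrime (n := n) (ℓ := ℓ) h.connects hlam hp hp1 hℓ4 hn hδ hδ1
        (hπ0 e₀) (hπ6 e₀ he₀) (hF _ (hidx e₀ he₀).1).1 (hK2 e₀ he₀)
      have h3 : Real.exp ((1 + δ) * μ) * p ^ C.card ≤ (n : ℝ) ^ (1 + 50000 * δ)
          * (K (idx e₀) * p ^ (2 * π e₀ * (1 + δ))) := by
        rw [← Real.log_le_log_iff (by positivity)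
            (mul_pos (by positivity) (mul_pos (hKpos e₀) (by positivity))),
          Real.log_mul (Real.exp_pos _).ne' (by positivity), Real.log_exp, Real.log_pow,
          Real.log_mul (by positivity) (mul_pos (hKpos e₀) (by positivity)).ne',
          Real.log_mul (hKpos e₀).ne' (by positivity), Real.log_rpow hn0, Real.log_rpow hp]
        have h4 : Real.log p = -P := by rw [hP, neg_neg]
        rw [h4]
        have h5 : y e₀ = 2 * (π e₀ * P) - κ e₀ - (1 + 30 * δ) * Λ := rfl
        have h6 : π e₀ * P ≤ 6000 * Λ := hb0 e₀ he₀
        have h7 : δ * (π e₀ * P) ≤ δ * (6000 * Λ) := mul_le_mul_of_nonneg_left h6 hδ.le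
        have h8 : 0 ≤ δ * Λ := mul_nonneg hδ.le (by linarith)
        have h9 : Real.log (K (idx e₀)) = κ e₀ := rfl
        rw [h9]
        linarith
      calc _ ≤ Real.exp ((1 + δ) * μ) * p ^ C.card :=
            mul_le_mul_of_nonneg_right ((hprod r).trans h1) (pow_pos hp _).le
        _ ≤ _ := h3
        _ = 4 / δ * (n : ℝ) ^ (1 + 50000 * δ)
            * (δ / 4 * K (idx e₀) * p ^ (2 * π e₀ * (1 + δ))) := by field_simp
        _ ≤ _ := mul_le_mul_of_nonneg_left h2 (by positivity)

end

section

open Classical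

/-! ### Union bound over the relevant cuts -/

theorem card_powerset_filter_card_le {β : Type*} (T : Finset β) (M : ℕ) :
    (T.powerset.filter fun F => F.card ≤ M).card ≤ (T.card + 1) ^ M := by
  have h1 : T.powerset.filter (fun F => F.card ≤ M)
      = (Finset.range (M + 1)).biUnion fun k => T.powersetCard k := by
    ext F
    simp only [Finset.mem_filter, Finset.mem_powerset, Finset.mem_biUnion, Finset.mem_range,
      Finset.mem_powersetCard]
    constructor
    · rintro ⟨h, h'⟩
      exact ⟨F.card, by omega, h, rfl⟩
    · rintro ⟨k, hk, h, rfl⟩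
      exact ⟨h, by omega⟩
  rw [h1, add_pow]
  refine Finset.card_biUnion_le.trans (Finset.sum_le_sum fun k hk => ?_)
  rw [Finset.card_powersetCard, one_pow, mul_one]
  calc T.card.choose k ≤ T.card ^ k := Nat.choose_le_pow _ _
    _ ≤ T.card ^ k * M.choose k :=
      Nat.le_mul_of_pos_right _ (Nat.choose_pos (by rw [Finset.mem_range] at hk; omega))

/-- If each cut of a family has a `θ` fraction of spanning trees that cross it in at most `M`
edges, the family has at most `n ^ M / θ` members: a cut is determined by the edges in which it
crosses a given tree. -/
theorem mul_card_cuts_le {α β : Type*} [Fintype β] {G : Graph α β} {n M R : ℕ} {θ : ℝ}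
    (hR : 0 < R) {𝒯 : Fin R → Finset β} (hT : ∀ r, IsSpanningTree G (𝒯 r))
    (hV : V(G).ncard ≤ n) {𝒞 : Finset (Finset β)} (h𝒞 : 𝒞 ⊆ cuts G)
    {S : Finset β → Finset (Fin R)} (hS : ∀ C ∈ 𝒞, θ * R ≤ (S C).card)
    (hM : ∀ C ∈ 𝒞, ∀ r ∈ S C, (𝒯 r ∩ C).card ≤ M) :
    (𝒞.card : ℝ) * θ ≤ (n : ℝ) ^ M := by
  have h1 : ∑ C ∈ 𝒞, (S C).card ≤ R * n ^ M := by
    calc ∑ C ∈ 𝒞, (S C).card = ∑ C ∈ 𝒞, ∑ r : Fin R, if r ∈ S C then 1 else 0 := by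
          refine Finset.sum_congr rfl fun C _ => ?_
          rw [← Finset.card_filter, Finset.filter_univ_mem]
      _ = ∑ r : Fin R, (𝒞.filter fun C => r ∈ S C).card := by
          rw [Finset.sum_comm]
          exact Finset.sum_congr rfl fun r _ => (Finset.card_filter _ _).symm
      _ ≤ ∑ r : Fin R, n ^ M := by
          refine Finset.sum_le_sum fun r _ => ?_
          have h2 : (𝒞.filter fun C => r ∈ S C).card
              ≤ ((𝒯 r).powerset.filter fun F => F.card ≤ M).card := by
            refine Finset.card_le_card_of_injOn (fun C => 𝒯 r ∩ C) ?_ ?_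
            · intro C hC
              have hC := Finset.mem_filter.1 (Finset.mem_coe.1 hC)
              exact Finset.mem_coe.2 (Finset.mem_filter.2
                ⟨Finset.mem_powerset.2 Finset.inter_subset_left, hM C hC.1 r hC.2⟩)
            · exact (inter_injOn_cuts (hT r).2.1).mono fun C hC =>
                h𝒞 (Finset.mem_filter.1 (Finset.mem_coe.1 hC)).1
          refine h2.trans ((card_powerset_filter_card_le _ _).trans ?_)
          gcongr
          rw [(hT r).2.2]
          exact hV
      _ = R * n ^ M := by rw [Finset.sum_const, Finset.card_univ, Fintype.card_fin, smul_eq_mul]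
  have h1' : ∑ C ∈ 𝒞, ((S C).card : ℝ) ≤ R * (n : ℝ) ^ M := by exact_mod_cast h1
  have h2 : (𝒞.card : ℝ) * (θ * R) ≤ ∑ C ∈ 𝒞, ((S C).card : ℝ) := by
    rw [← nsmul_eq_mul]
    exact Finset.card_nsmul_le_sum _ _ _ hS
  have hR' : (0 : ℝ) < R := by exact_mod_cast hR
  refine le_of_mul_le_mul_right ?_ hR'
  linarith

/-- Union bound: `N` independent uniform samples from `Fin R` hit all sets of a family, each of
density at least `θ`, except with probability `|𝒞| (1 - θ) ^ N`. -/
theorem le_toOuterMeasure_forall_exists {ι : Type*} {R N : ℕ} [NeZero R] {θ : ℝ}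
    {𝒞 : Finset ι} {S : ι → Finset (Fin R)} (hS : ∀ C ∈ 𝒞, θ * R ≤ (S C).card) :
    ENNReal.ofReal (1 - 𝒞.card * (1 - θ) ^ N) ≤
      (PMF.uniformOfFintype (Fin N → Fin R)).toOuterMeasure
        {s | ∀ C ∈ 𝒞, ∃ k, s k ∈ S C} := by
  have hR : (0 : ℝ) < R := by exact_mod_cast Nat.pos_of_ne_zero (NeZero.ne R)
  rw [PMF.toOuterMeasure_uniformOfFintype_apply]
  set good : Finset (Fin N → Fin R) :=
    Finset.univ.filter fun s => ∀ C ∈ 𝒞, ∃ k, s k ∈ S C with hgood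
  have hcard : Fintype.card {s : Fin N → Fin R | ∀ C ∈ 𝒞, ∃ k, s k ∈ S C} = good.card := by
    rw [hgood, ← Fintype.card_subtype]; rfl
  have hall : Fintype.card (Fin N → Fin R) = R ^ N := by simp
  have hbad : (Finset.univ.filter fun s : Fin N → Fin R => ¬ ∀ C ∈ 𝒞, ∃ k, s k ∈ S C)
      ⊆ 𝒞.biUnion fun C => Fintype.piFinset fun _ : Fin N => (S C)ᶜ := by
    intro s hs
    have hs := (Finset.mem_filter.1 hs).2
    push Not at hs
    obtain ⟨C, hC, hs⟩ := hs
    exact Finset.mem_biUnion.2 ⟨C, hC, Fintype.mem_piFinset.2 fun k =>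
      Finset.mem_compl.2 (hs k)⟩
  have h1 : ((Finset.univ.filter fun s : Fin N → Fin R =>
      ¬ ∀ C ∈ 𝒞, ∃ k, s k ∈ S C).card : ℝ) ≤ 𝒞.card * ((1 - θ) ^ N * R ^ N) := by
    calc _ ≤ ((∑ C ∈ 𝒞, (Fintype.piFinset fun _ : Fin N => (S C)ᶜ).card : ℕ) : ℝ) := by
          exact_mod_cast (Finset.card_le_card hbad).trans Finset.card_biUnion_le
      _ = ∑ C ∈ 𝒞, (((S C)ᶜ.card : ℝ)) ^ N := by
          push_cast
          refine Finset.sum_congr rfl fun C _ => ?_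
          rw [Fintype.card_piFinset, Finset.prod_const, Finset.card_univ, Fintype.card_fin]
          push_cast
          rfl
      _ ≤ ∑ C ∈ 𝒞, ((1 - θ) * R) ^ N := by
          refine Finset.sum_le_sum fun C hC => ?_
          gcongr
          have h2 : (S C)ᶜ.card + (S C).card = R := by
            rw [Finset.card_compl_add_card, Fintype.card_fin]
          have h2' : ((S C)ᶜ.card : ℝ) + (S C).card = R := by exact_mod_cast h2
          have := hS C hC
          linarith
      _ = _ := by rw [Finset.sum_const, nsmul_eq_mul, mul_pow]
  have h3 := Finset.card_filter_add_card_filter_not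
    (s := (Finset.univ : Finset (Fin N → Fin R))) (fun s => ∀ C ∈ 𝒞, ∃ k, s k ∈ S C)
  rw [Finset.card_univ, hall, ← hgood] at h3
  have h3' : (good.card : ℝ) + (Finset.univ.filter fun s : Fin N → Fin R =>
      ¬ ∀ C ∈ 𝒞, ∃ k, s k ∈ S C).card = (R : ℝ) ^ N := by exact_mod_cast h3
  have hRN : (0 : ℝ) < (R : ℝ) ^ N := by positivity
  have h4 : 1 - 𝒞.card * (1 - θ) ^ N ≤ (good.card : ℝ) / (R : ℝ) ^ N := by
    rw [le_div_iff₀ hRN]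
    linarith
  rw [hall]
  refine (ENNReal.ofReal_le_ofReal h4).trans (le_of_eq ?_)
  rw [ENNReal.ofReal_div_of_pos hRN, ENNReal.ofReal_natCast, ENNReal.ofReal_pow hR.le,
    ENNReal.ofReal_natCast, Nat.cast_pow]
  congr 2
  rw [← hcard]

/-! ### The likelihood ratio -/

/-- A good tree in the sample bounds the likelihood ratio. -/
theorem cutSampler_pos_and_likelihoodRatio_le {α β : Type*} [Fintype β] {G : Graph α β} {n : ℕ}
    {δ : ℝ} {ℓ : β → ℝ} {N : ℕ} [NeZero N] {𝒯' : Fin N → Finset β} {k : Fin N} {C : Finset β}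
    {p B : ℝ} (hp : 0 < p) (hz : 0 < zPrime G n ℓ p)
    (hT : Connects G ((𝒯' k : Finset β) : Set β)) (hC : C ∈ cuts G)
    (hcover : ∀ e ∈ 𝒯' k ∩ C, ∃ i : Fin (numLevels δ), e ∈ level G δ ℓ i)
    (hdisj : ∀ i j : Fin (numLevels δ), ∀ e, e ∈ level G δ ℓ i → e ∈ level G δ ℓ j → i = j)
    (hsmall : ((𝒯' k ∩ C).card : ℝ) ≤ 8 * Real.log n)
    (hB : ((∏ i : Fin (numLevels δ), (𝒯' k ∩ level G δ ℓ i).card.choose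
        ((𝒯' k ∩ C) ∩ level G δ ℓ i).card : ℕ) : ℝ) * p ^ C.card ≤ B * zPrime G n ℓ p) :
    0 < cutSampler G n δ ℓ 𝒯' C ∧
      likelihoodRatio G n ℓ p (cutSampler G n δ ℓ 𝒯') C
        ≤ N * (8 * Real.log n + 1) ^ numLevels δ * B := by
  set X : ℕ := ∏ i : Fin (numLevels δ), (𝒯' k ∩ level G δ ℓ i).card.choose
        ((𝒯' k ∩ C) ∩ level G δ ℓ i).card with hX
  set A : ℕ := (admissible G n δ ℓ (𝒯' k)).card with hA
  have hXpos : 0 < X := Finset.prod_pos fun i _ => Nat.choose_pos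
    (Finset.card_le_card (Finset.inter_subset_inter_right Finset.inter_subset_left))
  have hApos : 0 < A := Finset.card_pos.2 (admissible_nonempty G n δ ℓ (𝒯' k))
  have hNpos : 0 < N := Nat.pos_of_ne_zero (NeZero.ne N)
  set q := cutSampler G n δ ℓ 𝒯' with hq
  have h1 : (N : ENNReal)⁻¹ * ((A : ENNReal)⁻¹ * (X : ENNReal)⁻¹) ≤ q C := by
    refine le_trans ?_ (le_cutSampler 𝒯' k C)
    gcongr
    exact le_treeCutSampler hT hC hcover hdisj hsmall
  have hqtop : q C ≠ ⊤ := PMF.apply_ne_top q C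
  have h2 : (N : ℝ)⁻¹ * ((A : ℝ)⁻¹ * (X : ℝ)⁻¹) ≤ (q C).toReal := by
    have := ENNReal.toReal_mono hqtop h1
    simpa using this
  have hN' : (0 : ℝ) < N := by exact_mod_cast hNpos
  have hA' : (0 : ℝ) < A := by exact_mod_cast hApos
  have hX' : (0 : ℝ) < X := by exact_mod_cast hXpos
  have hqpos : 0 < (q C).toReal := lt_of_lt_of_le (by positivity) h2
  refine ⟨(ENNReal.toReal_pos_iff.1 hqpos).1, ?_⟩
  have hA2 : (A : ℝ) ≤ (8 * Real.log n + 1) ^ numLevels δ := card_admissible_le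
  rw [likelihoodRatio, div_le_iff₀ (by positivity)]
  have hBpos : 0 < B := by
    have h3 : 0 < B * zPrime G n ℓ p := lt_of_lt_of_le (mul_pos hX' (pow_pos hp _)) hB
    exact pos_of_mul_pos_left h3 hz.le
  have h3 : 1 ≤ N * A * X * (q C).toReal := by
    calc (1 : ℝ) = N * A * X * ((N : ℝ)⁻¹ * ((A : ℝ)⁻¹ * (X : ℝ)⁻¹)) := by field_simp
      _ ≤ _ := by gcongr
  calc p ^ C.card ≤ (N * A * X * (q C).toReal) * p ^ C.card :=
        le_mul_of_one_le_left (pow_pos hp _).le h3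
    _ = (N * A * (q C).toReal) * (X * p ^ C.card) := by ring
    _ ≤ (N * A * (q C).toReal) * (B * zPrime G n ℓ p) := by gcongr
    _ ≤ (N * (8 * Real.log n + 1) ^ numLevels δ * (q C).toReal) * (B * zPrime G n ℓ p) := by
        gcongr
    _ = _ := by ring

/-! ### Numerical estimates -/

theorem numLevels_le {δ : ℝ} (hδ : 0 < δ) (hδ1 : δ ≤ 1 / 10) : (numLevels δ : ℝ) ≤ 6 / δ := by
  have h1 : 10 / 11 * δ ≤ Real.log (1 + δ) := by
    have h2 := Real.one_sub_inv_le_log_of_pos (x := 1 + δ) (by positivity)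
    refine le_trans ?_ h2
    rw [show 1 - (1 + δ)⁻¹ = δ / (1 + δ) by field_simp; ring, le_div_iff₀ (by positivity)]
    nlinarith
  have h3 : Real.log 6 ≤ 5 := by
    have := Real.log_le_sub_one_of_pos (show (0 : ℝ) < 6 by norm_num)
    linarith
  have h0 : 0 ≤ Real.log 6 := Real.log_nonneg (by norm_num)
  have h4 : (⌈Real.log 6 / Real.log (1 + δ)⌉₊ : ℝ) < Real.log 6 / Real.log (1 + δ) + 1 :=
    Nat.ceil_lt_add_one (div_nonneg h0 (by nlinarith))
  have h5 : Real.log 6 / Real.log (1 + δ) ≤ 5.5 / δ := by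
    calc Real.log 6 / Real.log (1 + δ) ≤ 5 / (10 / 11 * δ) := by gcongr
      _ = 5.5 / δ := by field_simp; norm_num
  have h6 : 3 ≤ 0.5 / δ := by rw [le_div_iff₀ hδ]; linarith
  rw [numLevels]
  push_cast
  calc _ ≤ 5.5 / δ + 0.5 / δ := by linarith
    _ = 6 / δ := by ring

/-- All polylogarithmic factors together. -/
theorem polylog_bound {Λ δ a N : ℝ} (hΛ : 48 ≤ Λ) (hδ : 0 < δ) (hδ1 : δ ≤ 1 / 10)
    (hδΛ : 1 / Λ ≤ δ) (hN : N ≤ Λ ^ a) :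
    N * (8 * Λ + 1) ^ numLevels δ * (4 / δ) ≤ Λ ^ ((|a| + 50000) / δ) := by
  have hΛ0 : 0 < Λ := by linarith
  have hΛ1 : 1 ≤ Λ := by linarith
  have h1 : N ≤ Λ ^ (|a| / δ) := by
    refine hN.trans (Real.rpow_le_rpow_of_exponent_le hΛ1 ((le_abs_self a).trans ?_))
    rw [le_div_iff₀ hδ]
    nlinarith [abs_nonneg a]
  have h2 : (8 * Λ + 1) ^ numLevels δ ≤ Λ ^ (12 / δ) := by
    calc (8 * Λ + 1) ^ numLevels δ ≤ (Λ ^ (2 : ℝ)) ^ numLevels δ := by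
          gcongr
          rw [Real.rpow_two]
          nlinarith
      _ = Λ ^ (2 * (numLevels δ : ℝ)) := by rw [← Real.rpow_natCast, ← Real.rpow_mul hΛ0.le]
      _ ≤ Λ ^ (12 / δ) := by
          refine Real.rpow_le_rpow_of_exponent_le hΛ1 ?_
          calc 2 * (numLevels δ : ℝ) ≤ 2 * (6 / δ) := by gcongr; exact numLevels_le hδ hδ1
            _ = 12 / δ := by ring
  have h3 : 4 / δ ≤ Λ ^ (2 / δ) := by
    calc 4 / δ ≤ 4 * Λ := by
          rw [div_le_iff₀ hδ]
          rw [div_le_iff₀ hΛ0] at hδΛ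
          linarith
      _ ≤ Λ ^ (2 : ℝ) := by rw [Real.rpow_two]; nlinarith
      _ ≤ Λ ^ (2 / δ) := by
          refine Real.rpow_le_rpow_of_exponent_le hΛ1 ?_
          rw [le_div_iff₀ hδ]
          linarith
  calc N * (8 * Λ + 1) ^ numLevels δ * (4 / δ)
      ≤ Λ ^ (|a| / δ) * Λ ^ (12 / δ) * Λ ^ (2 / δ) := by gcongr
    _ = Λ ^ ((|a| + 14) / δ) := by
        rw [← Real.rpow_add hΛ0, ← Real.rpow_add hΛ0]
        congr 1
        ring
    _ ≤ _ := by
        refine Real.rpow_le_rpow_of_exponent_le hΛ1 ?_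
        gcongr
        norm_num

/-- The union bound over `k ≤ (2 / δ) n ^ M` cuts with `M ≤ 8 log n` leaves a failure probability
of at most `n ^ (-c)`. -/
theorem failure_bound {n M N : ℕ} {δ c k : ℝ} (hn : 48 + c ≤ Real.log n) (hc : 0 < c)
    (hδ : 0 < δ) (hδ1 : δ ≤ 1 / 10) (hδΛ : 1 / Real.log n ≤ δ) (hM : (M : ℝ) ≤ 8 * Real.log n)
    (hN : Real.log n ^ (4 : ℝ) ≤ N) (hk : k * (δ / 2) ≤ (n : ℝ) ^ M) :
    k * (1 - δ / 2) ^ N ≤ (n : ℝ) ^ (-c) := by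
  have hn0 : (0 : ℝ) < n := by
    rcases Nat.eq_zero_or_pos n with rfl | hpos
    · simp at hn; linarith
    · exact_mod_cast hpos
  set Λ := Real.log n with hΛ
  have hΛ0 : 0 < Λ := by linarith
  have h1 : k ≤ 2 / δ * (n : ℝ) ^ M := by
    rw [div_mul_eq_mul_div, le_div_iff₀ hδ]
    linarith
  have h2 : (1 - δ / 2) ^ N ≤ Real.exp (-(δ / 2 * N)) := by
    calc (1 - δ / 2) ^ N ≤ Real.exp (-(δ / 2)) ^ N := by
          refine pow_le_pow_left₀ (by linarith) ?_ _
          linarith [Real.add_one_le_exp (-(δ / 2))]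
      _ = _ := by rw [← Real.exp_nat_mul]; congr 1; ring
  have h3 : 2 / δ ≤ Real.exp (2 * Λ) := by
    calc 2 / δ ≤ 2 * Λ := by
          rw [div_le_iff₀ hδ]
          rw [div_le_iff₀ hΛ0] at hδΛ
          linarith
      _ ≤ Real.exp (2 * Λ) := by linarith [Real.add_one_le_exp (2 * Λ)]
  have h4 : (n : ℝ) ^ M ≤ Real.exp (8 * Λ * Λ) := by
    rw [← Real.exp_log (pow_pos hn0 M), Real.log_pow]
    exact Real.exp_le_exp.2 (mul_le_mul_of_nonneg_right hM hΛ0.le)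
  have h5 : (n : ℝ) ^ (-c) = Real.exp (-(c * Λ)) := by
    rw [Real.rpow_def_of_pos hn0]; congr 1; rw [← hΛ]; ring
  have h6 : Λ ^ 3 / 2 ≤ δ / 2 * N := by
    have h7 : Λ ^ (4 : ℝ) = Λ ^ 3 * Λ := by
      rw [show (4 : ℝ) = ((4 : ℕ) : ℝ) by norm_num, Real.rpow_natCast]; ring
    rw [div_le_iff₀ hΛ0] at hδΛ
    calc Λ ^ 3 / 2 = Λ ^ 3 / 2 * 1 := by ring
      _ ≤ Λ ^ 3 / 2 * (δ * Λ) := by gcongr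
      _ = δ / 2 * (Λ ^ (4 : ℝ)) := by rw [h7]; ring
      _ ≤ _ := by gcongr
  calc k * (1 - δ / 2) ^ N ≤ 2 / δ * (n : ℝ) ^ M * Real.exp (-(δ / 2 * N)) := by
        have : 0 ≤ (1 - δ / 2) ^ N := pow_nonneg (by linarith) _
        gcongr
    _ ≤ Real.exp (2 * Λ) * Real.exp (8 * Λ * Λ) * Real.exp (-(δ / 2 * N)) := by gcongr
    _ = Real.exp (2 * Λ + 8 * Λ * Λ + -(δ / 2 * N)) := by rw [Real.exp_add, Real.exp_add]
    _ ≤ _ := by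
        rw [h5]
        refine Real.exp_le_exp.2 ?_
        have h8 : (48 + c) * (Λ * Λ) ≤ Λ * (Λ * Λ) := by gcongr
        have h9 : Λ ≤ Λ * Λ := by nlinarith
        have h10 : c * Λ * 48 ≤ c * Λ * Λ := by gcongr; linarith
        have h11 : 0 ≤ c * Λ := by positivity
        nlinarith

theorem eventually_large (c₁ c₂ c : ℝ) (hc₁ : 0 < c₁) (hc₂ : 0 < c₂) :
    ∃ n₀ : ℕ, ∀ n : ℕ, n₀ ≤ n → 48 + c ≤ Real.log n ∧
      0 < c₁ / Real.log (Real.log n) ∧ 1 / Real.log n ≤ c₁ / Real.log (Real.log n) ∧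
      c₂ / Real.log (Real.log n) ≤ 1 / 10 := by
  have hlog : Filter.Tendsto (fun n : ℕ => Real.log n) Filter.atTop Filter.atTop :=
    Real.tendsto_log_atTop.comp tendsto_natCast_atTop_atTop
  have hloglog := Real.tendsto_log_atTop.comp hlog
  have hsmall := (Real.isLittleO_log_id_atTop.comp_tendsto hlog).def hc₁
  have hev := (hlog.eventually_ge_atTop (48 + c)).and ((hlog.eventually_ge_atTop 1).and
    ((hloglog.eventually_ge_atTop (max 1 (10 * c₂))).and hsmall))
  obtain ⟨n₀, hn₀⟩ := Filter.eventually_atTop.1 hev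
  refine ⟨n₀, fun n hn => ?_⟩
  obtain ⟨h1, h2, h3, h4⟩ := hn₀ n hn
  simp only [Function.comp_apply, id] at h3 h4
  have h5 : (0 : ℝ) < Real.log n := by linarith
  have h6 : 1 ≤ Real.log (Real.log n) := (le_max_left _ _).trans h3
  have h7 : 10 * c₂ ≤ Real.log (Real.log n) := (le_max_right _ _).trans h3
  rw [Real.norm_of_nonneg (by linarith), Real.norm_of_nonneg h5.le] at h4
  refine ⟨h1, by positivity, ?_, ?_⟩
  · rw [div_le_div_iff₀ h5 (by linarith)]
    linarith
  · rw [div_le_iff₀ (by linarith)]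
    linarith

end

end

theorem mainTheorem5 :
    ∃ κ : ℝ, 0 < κ ∧ ∃ a₀ : ℝ, 0 < a₀ ∧ ∀ a : ℝ, ∃ K : ℝ, 0 < K ∧
    ∀ c₁ c₂ c : ℝ, 0 < c₁ → 0 < c₂ → 0 < c → ∃ n₀ : ℕ, ∀ n : ℕ, n₀ ≤ n →
    -- `δ = Θ(1 / log log n)`, and `ε` is the accuracy parameter of the tree packing
    ∀ δ : ℝ, c₁ / Real.log (Real.log n) ≤ δ → δ ≤ c₂ / Real.log (Real.log n) →
    ∀ ε : ℝ, 0 < ε → ε ≤ κ * δ →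
    ∀ (α : Type*) (β : Type*) [Fintype α] [Fintype β] (G : Graph α β),
    2 ≤ V(G).ncard → V(G).ncard ≤ n → Connects G E(G) →
    StrongComponentsTrivial G (3 * minCut G) →
    -- the tree packing: the latter half of a greedy tree packing of `2 * R` trees
    ∀ (R : ℕ) [NeZero R], 6 * minCut G * Real.log (E(G).ncard) / ε ^ 2 ≤ R →
    ∀ T : ℕ → Finset β, IsGreedyTreePacking G (2 * R) T →
    ∀ p : ℝ, 0 < p → p < 1 →
    (∀ i : ℕ, (n : ℝ) ^ (1 + 30 * δ) * kTilde G δ (load (latterHalf T R)) i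
        * p ^ (2 * levelPi (minCut G) δ i) ≤ 1) →
    (n : ℝ) ^ (-1000 : ℝ) ≤ p ^ minCut G →
    -- the sparsified packing: `N` trees sampled uniformly with replacement
    ∀ (N : ℕ) [NeZero N], Real.log n ^ a₀ ≤ N → N ≤ Real.log n ^ a →
    ENNReal.ofReal (1 - (n : ℝ) ^ (-c)) ≤
      (PMF.uniformOfFintype (Fin N → Fin R)).toOuterMeasure
        {s | ∀ C ∈ relevantCuts G n (load (latterHalf T R)),
          0 < cutSampler G n δ (load (latterHalf T R)) (fun k => latterHalf T R (s k)) C ∧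
          likelihoodRatio G n (load (latterHalf T R)) p
              (cutSampler G n δ (load (latterHalf T R)) fun k => latterHalf T R (s k)) C
            ≤ Real.log n ^ (K / δ) * (n : ℝ) ^ (1 + K * δ)} := by
  classical
  -- With `ε ≤ δ / 600` the loads are accurate up to a factor `1 + O(δ / 100)`. Since `δ` is at least
  -- `1 / log n`, a sample of `log ^ 4 n` trees beats the `n ^ O(log n)` relevant cuts.
  refine ⟨1 / 600, by norm_num, 4, by norm_num, fun a => ⟨|a| + 50000, by positivity, ?_⟩⟩
  intro c₁ c₂ c hc₁ hc₂ hc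
  obtain ⟨n₀, hn₀⟩ := eventually_large c₁ c₂ c hc₁ hc₂
  refine ⟨n₀, fun n hn δ hδl hδu ε hε hεδ α β _ _ G hV2 hVn hG hS R _ hR T hT p hp hp1 hassum
    hp1000 N _ hN hNa => ?_⟩
  obtain ⟨hΛ, hpos, hδΛ, h10⟩ := hn₀ n hn
  have hδ : 0 < δ := hpos.trans_le hδl
  have hδ1 : δ ≤ 1 / 10 := hδu.trans h10
  have hδΛ : 1 / Real.log n ≤ δ := hδΛ.trans hδl
  have hRpos : 0 < R := Nat.pos_of_ne_zero (NeZero.ne R)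
  have h : IsAccuratePacking G R T (δ / 100) := by
    refine ⟨hV2, hG, hS, hT, hRpos, by positivity, by linarith, ?_⟩
    rw [div_le_iff₀ (by positivity)] at hR
    have h1 : ε ^ 2 ≤ (1 / 600 * δ) ^ 2 := by gcongr
    calc 36 * (6 * (minCut G : ℝ)) * Real.log E(G).ncard
        = 36 * (6 * minCut G * Real.log E(G).ncard) := by ring
      _ ≤ 36 * (R * ε ^ 2) := by gcongr
      _ ≤ 36 * (R * (1 / 600 * δ) ^ 2) := by gcongr
      _ = R * (δ / 100) ^ 2 := by ring
  have hlam := h.minCut_pos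
  have hn0 : (0 : ℝ) < n := by
    have : 0 < n := by omega
    exact_mod_cast this
  set ℓ := load (latterHalf T R) with hℓ
  have hgood : ∀ C, ∃ S : Finset (Fin R), C ∈ relevantCuts G n ℓ → _ := fun C => by
    by_cases hC : C ∈ relevantCuts G n ℓ
    · obtain ⟨S, hS⟩ := exists_good_trees h hδ1 (by linarith) hVn hp hp1 hassum hp1000 hC
      exact ⟨S, fun _ => hS⟩
    · exact ⟨∅, fun h => absurd h hC⟩
  choose S hS using hgood
  have hfrac : ∀ C ∈ relevantCuts G n ℓ, δ / 2 * R ≤ (S C).card := fun C hC => (hS C hC).1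
  have htree : ∀ r : Fin R, IsSpanningTree G (latterHalf T R r) := fun r =>
    (hT (R + r) (by have := r.2; omega)).1
  have hcount := mul_card_cuts_le (M := ⌊8 * Real.log n⌋₊) hRpos htree hVn
    (fun C hC => (mem_relevantCuts.1 hC).1) hfrac
    (fun C hC r hr => Nat.le_floor ((hS C hC).2 r hr).1)
  have hfail := failure_bound (N := N) hΛ hc hδ hδ1 hδΛ (Nat.floor_le (by linarith)) hN hcount
  refine (ENNReal.ofReal_le_ofReal (by linarith)).trans
    ((le_toOuterMeasure_forall_exists (N := N) hfrac).trans
      (MeasureTheory.measure_mono fun s hs C hC => ?_))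
  obtain ⟨k, hk⟩ := hs C hC
  obtain ⟨hsmall, hbound⟩ := (hS C hC).2 _ hk
  have hCcut := (mem_relevantCuts.1 hC).1
  have hzpos : 0 < zPrime G n ℓ p :=
    Finset.sum_pos (fun C _ => pow_pos hp _) ⟨C, hC⟩
  obtain ⟨h1, h2⟩ := cutSampler_pos_and_likelihoodRatio_le
    (𝒯' := fun k => latterHalf T R (s k)) (k := k) hp hzpos (htree _).2.1 hCcut
    (fun e he => by
      obtain ⟨x, y, hl, hxy⟩ := exists_isLink_of_mem_cut hCcut (Finset.mem_inter.1 he).2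
      obtain ⟨i, hi, hie⟩ := h.exists_mem_level hδ1 hl hxy
      exact ⟨⟨i, hi⟩, hie⟩)
    (fun i j e hi hj => Fin.ext (level_unique hlam hδ.le hi hj)) hsmall hbound
  refine ⟨h1, h2.trans ?_⟩
  have h3 := polylog_bound (by linarith) hδ hδ1 hδΛ hNa
  have hn1 : (1 : ℝ) ≤ n := by exact_mod_cast (show 1 ≤ n by omega)
  calc _ = N * (8 * Real.log n + 1) ^ numLevels δ * (4 / δ) * (n : ℝ) ^ (1 + 50000 * δ) := by ring
    _ ≤ Real.log n ^ ((|a| + 50000) / δ) * (n : ℝ) ^ (1 + (|a| + 50000) * δ) := by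
        gcongr
        linarith [abs_nonneg a]
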